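/- Let $H\le K\le G$ be compact Lie groups ($H,K$ closed subgroups of the compact Lie group $G$) with Lie algebras $\mathfrak h\subset\mathfrak k\subset\mathfrak g$, let $b$ be an $\mathrm{Ad}(G)$-invariant inner product on $\mathfrak g$, and put $\mathfrak m_1=\mathfrak h^{\perp}\cap\mathfrak k$ and $\mathfrak m_2=\mathfrak k^{\perp}$ (orthogonal complements with respect to $b$), so that $\mathfrak m:=\mathfrak h^\perp=\mathfrak m_1\oplus\mathfrak m_2\cong T_o(G/H)$, where $o=eH$. For $X\in\mathfrak g$ let $X^*$ be the vector field on $G/H$ induced by $X$, $X^*_p=\frac{d}{dt}\big|_{t=0}\exp(tX)\cdot p$. For $\lambda>0$ let $\langle\cdot,\cdot\rangle_\lambda$ be the $G$-invariant Riemannian metric on $M=G/H$ determined by $$\langle X^*_o,Y^*_o\rangle_\lambda=\lambda\,b(X_{\mathfrak m_1},Y_{\mathfrak m_1})+b(X_{\mathfrak m_2},Y_{\mathfrak m_2}),\qquad X,Y\in\mathfrak m,$$ where $(\cdot)_{\mathfrak m_i}$ denotes the orthogonal projection onto $\mathfrak m_i$. An infinitesimal transvection of a Riemannian manifold at a point $p$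 is a Killing vector field $X$ with $(\nabla X)_p=0$, where $\nabla$ is the Levi-Civita connection. Let $\xi\in\mathfrak m_1$. If, for some $\lambda>0$, the restriction of $\xi^*$ to the fiber $F=K/H\subset G/H$ of $G/H\to G/K$ through $o$ is an infinitesimal transvection at $o$ of $F$ with the metric induced by $\langle\cdot,\cdot\rangle_\lambda$, then $\xi^*$ is an infinitesimal transvection of $M=G/H$ at $o$ with respect to $\langle\cdot,\cdot\rangle_2$. -/

import Mathlib

open scoped Manifold ContDiff Bundle
open Bundle VectorField

noncomputable section
section LeviCivita
variable {E : Type*} [NormedAddCommGroup E] [NormedSpace ℝ E]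
  {H : Type*} [TopologicalSpace H] {I : ModelWithCorners ℝ E H}
  {M : Type*} [TopologicalSpace M] [ChartedSpace H M] [IsManifold I ∞ M]

variable (I M) in
/-- A smooth Riemannian metric on the manifold `M`. -/
abbrev SmoothMetric : Type _ :=
  ContMDiffRiemannianMetric I ∞ E (TangentSpace I : M → Type _)

namespace SmoothMetric

/-- The function `⟨X, Y⟩` of two vector fields. -/
def pair (g : SmoothMetric I M) (X Y : Π x : M, TangentSpace I x) (x : M) : ℝ :=
  g.inner x (X x) (Y x)

theorem pair_mdiff (g : SmoothMetric I M) {X Y : Π x : M, TangentSpace I x} {x : M}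
    (hX : MDiffAt (T% X) x) (hY : MDiffAt (T% Y) x) : MDiffAt (pair g X Y) x := by
  have h : MDifferentiableAt I (I.prod 𝓘(ℝ))
      (fun m ↦ TotalSpace.mk' ℝ (E := Bundle.Trivial M ℝ) m (g.inner m (X m) (Y m))) x := by
    apply MDifferentiableAt.clm_bundle_apply₂ (F₁ := E) (F₂ := E)
    · exact g.contMDiff.mdifferentiableAt (by simp)
    · exact hX
    · exact hY
  simp only [mdifferentiableAt_totalSpace] at h
  exact h.2

theorem pair_add_left (g : SmoothMetric I M) (X X' Y : Π x : M, TangentSpace I x) :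
    pair g (X + X') Y = pair g X Y + pair g X' Y := by
  ext x; simp [pair]

theorem pair_add_right (g : SmoothMetric I M) (X Y Y' : Π x : M, TangentSpace I x) :
    pair g X (Y + Y') = pair g X Y + pair g X Y' := by
  ext x; simp [pair]

theorem pair_smul_left (g : SmoothMetric I M) (f : M → ℝ) (X Y : Π x : M, TangentSpace I x) :
    pair g (f • X) Y = f * pair g X Y := by
  ext x; simp [pair]

theorem pair_smul_right (g : SmoothMetric I M) (f : M → ℝ) (X Y : Π x : M, TangentSpace I x) :
    pair g X (f • Y) = f * pair g X Y := by
  ext x; simp [pair]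

/-- The right-hand side of the Koszul formula
`2⟨∇_X Y, Z⟩ = X⟨Y, Z⟩ + Y⟨X, Z⟩ - Z⟨X, Y⟩ + ⟨[X, Y], Z⟩ - ⟨[X, Z], Y⟩ - ⟨[Y, Z], X⟩` at `x`. -/
def koszul (g : SmoothMetric I M) (x : M) (Y X Z : Π x : M, TangentSpace I x) : ℝ :=
  d% (pair g Y Z) x (X x) + d% (pair g X Z) x (Y x) - d% (pair g X Y) x (Z x)
    + g.inner x (mlieBracket I X Y x) (Z x) - g.inner x (mlieBracket I X Z x) (Y x)
    - g.inner x (mlieBracket I Y Z x) (X x)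


/-- The scalar product at `x` as a bilinear form. -/
def form (g : SmoothMetric I M) (x : M) : LinearMap.BilinForm ℝ (TangentSpace I x) :=
  LinearMap.mk₂ ℝ (fun v w ↦ g.inner x v w) (by simp) (by simp) (by simp) (by simp)

theorem form_nondegenerate (g : SmoothMetric I M) (x : M) : (form g x).Nondegenerate := by
  refine ⟨fun v hv ↦ ?_, fun v hv ↦ ?_⟩ <;>
  · by_contra h
    exact (g.pos x v h).ne' (hv v)

/-- A vector is determined by its scalar products with the values of differentiable fields. -/
theorem ext_inner (g : SmoothMetric I M) {x : M} {v w : TangentSpace I x}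
    (h : ∀ Z : Π x : M, TangentSpace I x, MDiffAt (T% Z) x →
      g.inner x v (Z x) = g.inner x w (Z x)) : v = w := by
  by_contra hne
  have h1 := h (FiberBundle.extend E (v - w)) (FiberBundle.mdifferentiableAt_extend ..)
  have h2 := g.pos x (v - w) (sub_ne_zero.mpr hne)
  rw [FiberBundle.extend_apply_self] at h1
  simp only [map_sub, _root_.sub_apply] at h1 h2
  linarith

variable [FiniteDimensional ℝ E]

theorem koszul_tensorial_left (g : SmoothMetric I M) (x : M) {Y Z : Π x : M, TangentSpace I x}
    (hY : MDiffAt (T% Y) x) (hZ : MDiffAt (T% Z) x) :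
    TensorialAt I E (fun X ↦ koszul g x Y X Z) x where
  smul {f X} hf hX := by
    have := FiniteDimensional.complete ℝ E
    simp only [koszul, pair_smul_left, mvfderiv_mul hf (pair_mdiff g hX hZ),
      mvfderiv_mul hf (pair_mdiff g hX hY), mlieBracket_smul_left hf hX]
    simp [pair]
    ring
  add {X X'} hX hX' := by
    have := FiniteDimensional.complete ℝ E
    simp only [koszul, pair_add_left, mvfderiv_add (pair_mdiff g hX hZ) (pair_mdiff g hX' hZ),
      mvfderiv_add (pair_mdiff g hX hY) (pair_mdiff g hX' hY), mlieBracket_add_left hX hX']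
    simp
    ring

theorem koszul_tensorial_right (g : SmoothMetric I M) (x : M) {Y X : Π x : M, TangentSpace I x}
    (hY : MDiffAt (T% Y) x) (hX : MDiffAt (T% X) x) :
    TensorialAt I E (fun Z ↦ koszul g x Y X Z) x where
  smul {f Z} hf hZ := by
    have := FiniteDimensional.complete ℝ E
    simp only [koszul, pair_smul_right, mvfderiv_mul hf (pair_mdiff g hX hZ),
      mvfderiv_mul hf (pair_mdiff g hY hZ), mlieBracket_smul_right hf hZ]
    simp [pair, g.symm x (Z x)]
    ring
  add {Z Z'} hZ hZ' := by
    have := FiniteDimensional.complete ℝ E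
    simp only [koszul, pair_add_right, mvfderiv_add (pair_mdiff g hX hZ) (pair_mdiff g hX hZ'),
      mvfderiv_add (pair_mdiff g hY hZ) (pair_mdiff g hY hZ'), mlieBracket_add_right hZ hZ']
    simp
    ring

theorem koszul_add (g : SmoothMetric I M) (x : M) {Y Y' X Z : Π x : M, TangentSpace I x}
    (hY : MDiffAt (T% Y) x) (hY' : MDiffAt (T% Y') x) (hX : MDiffAt (T% X) x)
    (hZ : MDiffAt (T% Z) x) :
    koszul g x (Y + Y') X Z = koszul g x Y X Z + koszul g x Y' X Z := by
  have := FiniteDimensional.complete ℝ E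
  simp only [koszul, pair_add_right, pair_add_left,
    mvfderiv_add (pair_mdiff g hY hZ) (pair_mdiff g hY' hZ),
    mvfderiv_add (pair_mdiff g hX hY) (pair_mdiff g hX hY'), mlieBracket_add_right hY hY',
    mlieBracket_add_left hY hY']
  simp
  ring

theorem koszul_smul (g : SmoothMetric I M) (x : M) {f : M → ℝ} {Y X Z : Π x : M, TangentSpace I x}
    (hf : MDiffAt f x) (hY : MDiffAt (T% Y) x) (hX : MDiffAt (T% X) x)
    (hZ : MDiffAt (T% Z) x) :
    koszul g x (f • Y) X Z
      = f x * koszul g x Y X Z + 2 * (d% f x (X x) * g.inner x (Y x) (Z x)) := by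
  have := FiniteDimensional.complete ℝ E
  simp only [koszul, pair_smul_right, pair_smul_left, mvfderiv_mul hf (pair_mdiff g hX hY),
      mvfderiv_mul hf (pair_mdiff g hY hZ), mlieBracket_smul_right hf hY,
      mlieBracket_smul_left hf hY]
  simp [pair, g.symm x (X x)]
  ring

/-- The vector representing a linear form on the tangent space at `x`. -/
def riesz (g : SmoothMetric I M) (x : M) :
    (TangentSpace I x →L[ℝ] ℝ) →ₗ[ℝ] TangentSpace I x :=
  have : FiniteDimensional ℝ (TangentSpace I x) := inferInstanceAs (FiniteDimensional ℝ E)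
  ((form g x).toDual (form_nondegenerate g x)).symm.toLinearMap ∘ₗ
    ContinuousLinearMap.coeLM ℝ

theorem riesz_spec (g : SmoothMetric I M) (x : M) (φ : TangentSpace I x →L[ℝ] ℝ)
    (v : TangentSpace I x) : g.inner x (riesz g x φ) v = φ v := by
  have : FiniteDimensional ℝ (TangentSpace I x) := inferInstanceAs (FiniteDimensional ℝ E)
  exact LinearMap.BilinForm.apply_toDual_symm_apply (hB := form_nondegenerate g x)
    (φ : TangentSpace I x →ₗ[ℝ] ℝ) v

open Classical in
/-- The endomorphism `(∇Y)_x`, that is `v ↦ ∇_v Y`, given by the Koszul formula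
(zero by convention if `Y` is not differentiable at `x`). -/
def nabla (g : SmoothMetric I M) (Y : Π x : M, TangentSpace I x) (x : M) :
    TangentSpace I x →L[ℝ] TangentSpace I x :=
  if hY : MDiffAt (T% Y) x then
    have : FiniteDimensional ℝ (TangentSpace I x) := inferInstanceAs (FiniteDimensional ℝ E)
    have : T2Space (TangentSpace I x) := inferInstanceAs (T2Space E)
    LinearMap.toContinuousLinearMap ((2⁻¹ : ℝ) • (riesz g x ∘ₗ
      (TensorialAt.mkHom₂ (koszul g x Y) x
        (fun _ hZ ↦ koszul_tensorial_left g x hY hZ)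
        (fun _ hX ↦ koszul_tensorial_right g x hY hX)).toLinearMap))
  else 0

theorem nabla_spec (g : SmoothMetric I M) {Y : Π x : M, TangentSpace I x} {x : M}
    (hY : MDiffAt (T% Y) x) {X Z : Π x : M, TangentSpace I x}
    (hX : MDiffAt (T% X) x) (hZ : MDiffAt (T% Z) x) :
    2 * g.inner x (nabla g Y x (X x)) (Z x) = koszul g x Y X Z := by
  have h' := TensorialAt.mkHom₂_apply
    (fun _ hZ ↦ koszul_tensorial_left g x hY hZ)
    (fun _ hX ↦ koszul_tensorial_right g x hY hX) hX hZ
  rw [← h', nabla, dif_pos hY]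
  refine Eq.trans ?_ (riesz_spec g x _ (Z x))
  change 2 * g.inner x ((2⁻¹ : ℝ) • riesz g x _) (Z x) = _
  rw [map_smul]
  change 2 * (2⁻¹ * g.inner x (riesz g x _) (Z x)) = _
  rw [mul_inv_cancel_left₀ two_ne_zero]
  rfl

/-- The Levi-Civita connection of a Riemannian metric. -/
def leviCivita (g : SmoothMetric I M) :
    CovariantDerivative I E (TangentSpace I : M → Type _) where
  toFun := nabla g
  isCovariantDerivativeOnUniv :=
    { add := by
        intro Y Y' x hY hY' _
        ext v
        refine ext_inner g fun Z hZ ↦ ?_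
        have hX : MDiffAt (T% (FiberBundle.extend E v)) x := FiberBundle.mdifferentiableAt_extend ..
        have e := nabla_spec g (mdifferentiableAt_add_section hY hY') hX hZ
        have e1 := nabla_spec g hY hX hZ
        have e2 := nabla_spec g hY' hX hZ
        rw [koszul_add g x hY hY' hX hZ] at e
        rw [FiberBundle.extend_apply_self] at e e1 e2
        simp only [_root_.add_apply, map_add]
        linarith
      leibniz := by
        intro Y f x hY hf _
        ext v
        refine ext_inner g fun Z hZ ↦ ?_
        have hX : MDiffAt (T% (FiberBundle.extend E v)) x := FiberBundle.mdifferentiableAt_extend ..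
        have e := nabla_spec g (hf.smul_section hY) hX hZ
        have e1 := nabla_spec g hY hX hZ
        have e3 := koszul_smul g x hf hY hX hZ
        rw [FiberBundle.extend_apply_self] at e e1 e3
        simp only [_root_.add_apply, map_add, _root_.smul_apply, map_smul,
          ContinuousLinearMap.smulRight_apply, smul_eq_mul]
        change 2 * g.inner x (nabla g (f • Y) x v) (Z x) = _ at e
        linear_combination (1 / 2) * e + (1 / 2) * e3 - (1 / 2) * f x * e1 }

/-- The Levi-Civita connection is torsion-free. -/
theorem leviCivita_torsion (g : SmoothMetric I M) {X Y : Π x : M, TangentSpace I x} {x : M}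
    (hX : MDiffAt (T% X) x) (hY : MDiffAt (T% Y) x) :
    leviCivita g Y x (X x) - leviCivita g X x (Y x) = mlieBracket I X Y x := by
  refine ext_inner g fun Z hZ ↦ ?_
  have e1 := nabla_spec g hY hX hZ
  have e2 := nabla_spec g hX hY hZ
  have e3 : mlieBracket I Y X x = - mlieBracket I X Y x := mlieBracket_swap_apply
  have e4 : pair g X Y = pair g Y X := funext fun y ↦ g.symm y _ _
  change g.inner x (nabla g Y x (X x) - nabla g X x (Y x)) (Z x) = _
  simp only [koszul, e3, e4, map_sub, map_neg, _root_.sub_apply,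
    _root_.neg_apply] at e1 e2 ⊢
  linarith

/-- The Levi-Civita connection is metric. -/
theorem leviCivita_metric (g : SmoothMetric I M) {X Y Z : Π x : M, TangentSpace I x} {x : M}
    (hX : MDiffAt (T% X) x) (hY : MDiffAt (T% Y) x) (hZ : MDiffAt (T% Z) x) :
    d% (pair g Y Z) x (X x)
      = g.inner x (leviCivita g Y x (X x)) (Z x) + g.inner x (Y x) (leviCivita g Z x (X x)) := by
  have e1 := nabla_spec g hY hX hZ
  have e2 := nabla_spec g hZ hX hY
  have e3 : mlieBracket I Z Y x = - mlieBracket I Y Z x := mlieBracket_swap_apply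
  have e4 : pair g Z Y = pair g Y Z := funext fun y ↦ g.symm y _ _
  rw [g.symm x (Y x)]
  change _ = g.inner x (nabla g Y x (X x)) (Z x) + g.inner x (nabla g Z x (X x)) (Y x)
  simp only [koszul, e3, e4, map_neg, _root_.neg_apply] at e1 e2 ⊢
  linarith

/-- A torsion-free metric connection is the Levi-Civita connection. -/
theorem eq_leviCivita (g : SmoothMetric I M)
    (cov : CovariantDerivative I E (TangentSpace I : M → Type _))
    (htor : ∀ {X Y : Π x : M, TangentSpace I x} {x : M}, MDiffAt (T% X) x → MDiffAt (T% Y) x →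
      cov Y x (X x) - cov X x (Y x) = mlieBracket I X Y x)
    (hmet : ∀ {X Y Z : Π x : M, TangentSpace I x} {x : M}, MDiffAt (T% X) x → MDiffAt (T% Y) x →
      MDiffAt (T% Z) x →
      d% (pair g Y Z) x (X x) = g.inner x (cov Y x (X x)) (Z x) + g.inner x (Y x) (cov Z x (X x)))
    {Y : Π x : M, TangentSpace I x} {x : M} (hY : MDiffAt (T% Y) x) :
    cov Y x = leviCivita g Y x := by
  ext v
  refine ext_inner g fun Z hZ ↦ ?_
  have hX : MDiffAt (T% (FiberBundle.extend E v)) x := FiberBundle.mdifferentiableAt_extend ..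
  have e := nabla_spec g hY hX hZ
  rw [koszul, hmet hX hY hZ, hmet hY hX hZ, hmet hZ hX hY, ← htor hX hY, ← htor hX hZ,
    ← htor hY hZ] at e
  simp only [map_sub, _root_.sub_apply, FiberBundle.extend_apply_self] at e
  rw [g.symm x (Y x), g.symm x v, g.symm x v] at e
  change _ = g.inner x (nabla g Y x v) (Z x)
  linarith

/-- `X` is a Killing vector field: it is smooth and `L_X ⟨·, ·⟩ = 0`, that is
`X⟨Y, Z⟩ = ⟨[X, Y], Z⟩ + ⟨Y, [X, Z]⟩` for all smooth vector fields `Y`, `Z`. -/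
def IsKilling (g : SmoothMetric I M) (X : Π x : M, TangentSpace I x) : Prop :=
  CMDiff ∞ (T% X) ∧
    ∀ Y Z : Π x : M, TangentSpace I x, CMDiff ∞ (T% Y) → CMDiff ∞ (T% Z) → ∀ x : M,
      d% (pair g Y Z) x (X x) =
        g.inner x (mlieBracket I X Y x) (Z x) + g.inner x (Y x) (mlieBracket I X Z x)

/-- `X` is an infinitesimal transvection at `p`: a Killing vector field with `(∇X)_p = 0`. -/
def IsInfinitesimalTransvection (g : SmoothMetric I M) (X : Π x : M, TangentSpace I x)
    (p : M) : Prop :=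
  IsKilling g X ∧ leviCivita g X p = 0

end SmoothMetric
end LeviCivita

section HomogeneousFibration
variable {E : Type*} [NormedAddCommGroup E] [NormedSpace ℝ E]
  {G : Type*} [Group G] [TopologicalSpace G] [ChartedSpace E G] [LieGroup 𝓘(ℝ, E) ∞ G]

theorem hasMFDerivAt_mul_one (p : G × G) (hp : p = (1, 1)) :
    HasMFDerivAt (𝓘(ℝ, E).prod 𝓘(ℝ, E)) 𝓘(ℝ, E) (fun q : G × G ↦ q.1 * q.2) p
      (ContinuousLinearMap.fst ℝ E E + ContinuousLinearMap.snd ℝ E E : E × E →L[ℝ] E) := by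
  subst hp
  have hm : MDifferentiableAt (𝓘(ℝ, E).prod 𝓘(ℝ, E)) 𝓘(ℝ, E)
      (fun q : G × G ↦ q.1 * q.2) (1, 1) :=
    (contMDiff_mul 𝓘(ℝ, E) ∞).mdifferentiableAt (by simp)
  refine hm.hasMFDerivAt.congr_mfderiv (ContinuousLinearMap.ext fun v ↦ ?_)
  refine (mfderiv_prod_eq_add_apply (v := v) hm).trans ?_
  have e1 : (fun z : G ↦ z * 1) = id := funext mul_one
  have e2 : (fun z : G ↦ 1 * z) = id := funext one_mul
  dsimp only
  rw [e1, e2, mfderiv_id]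
  rfl

/-- The Lie algebra of a subgroup `H` of a Lie group `G`, as a subspace of the Lie algebra of `G`:
the velocities at `1` of smooth curves contained in `H`. -/
def subgroupLieAlgebra (H : Subgroup G) : Submodule ℝ (GroupLieAlgebra 𝓘(ℝ, E) G) where
  carrier := {X | ∃ γ : ℝ → G, ContMDiff 𝓘(ℝ, ℝ) 𝓘(ℝ, E) ∞ γ ∧ (∀ t, γ t ∈ H) ∧ γ 0 = 1 ∧
    mfderiv 𝓘(ℝ, ℝ) 𝓘(ℝ, E) γ 0 (1 : ℝ) = X}
  zero_mem' := by
    refine ⟨fun _ ↦ 1, contMDiff_const, fun _ ↦ H.one_mem, rfl, ?_⟩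
    rw [mfderiv_const]
    rfl
  add_mem' := by
    rintro X Y ⟨γ, hγ, hγH, hγ0, rfl⟩ ⟨δ, hδ, hδH, hδ0, rfl⟩
    refine ⟨fun t ↦ γ t * δ t, hγ.mul hδ, fun t ↦ H.mul_mem (hγH t) (hδH t), by simp [hγ0, hδ0], ?_⟩
    have h1 := (hγ.mdifferentiableAt (x := 0) (by simp)).hasMFDerivAt
    have h2 := (hδ.mdifferentiableAt (x := 0) (by simp)).hasMFDerivAt
    have h3 := HasMFDerivAt.comp (0 : ℝ)
      (hasMFDerivAt_mul_one (E := E) (γ 0, δ 0) (by rw [hγ0, hδ0])) (h1.prodMk h2)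
    exact congrArg (fun L : ℝ →L[ℝ] E ↦ L 1) h3.mfderiv
  smul_mem' := by
    rintro c X ⟨γ, hγ, hγH, hγ0, rfl⟩
    have hc : ContMDiff 𝓘(ℝ, ℝ) 𝓘(ℝ, ℝ) ∞ (fun t : ℝ ↦ c * t) :=
      (contDiff_const.mul contDiff_id).contMDiff
    refine ⟨fun t ↦ γ (c * t), hγ.comp hc, fun t ↦ hγH _, by simp [hγ0], ?_⟩
    have h1 : HasMFDerivAt 𝓘(ℝ, ℝ) 𝓘(ℝ, E) γ (c * 0)
        (mfderiv 𝓘(ℝ, ℝ) 𝓘(ℝ, E) γ 0 : ℝ →L[ℝ] E) := by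
      have := (hγ.mdifferentiableAt (x := 0) (by simp)).hasMFDerivAt
      rw [mul_zero]
      exact this
    have h2 : HasMFDerivAt 𝓘(ℝ, ℝ) 𝓘(ℝ, ℝ) (fun t : ℝ ↦ c * t) 0
        (c • ContinuousLinearMap.id ℝ ℝ) :=
      ((hasFDerivAt_id (0 : ℝ)).const_mul c).hasMFDerivAt
    have h3 := HasMFDerivAt.comp (0 : ℝ) h1 h2
    refine (congrArg (fun L : ℝ →L[ℝ] E ↦ L 1) h3.mfderiv).trans ?_
    change (mfderiv 𝓘(ℝ, ℝ) 𝓘(ℝ, E) γ 0 : ℝ →L[ℝ] E) (c • 1) = _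
    rw [map_smul]
    rfl

/-- The adjoint representation of `G` on its Lie algebra. -/
def adjointRep (a : G) : GroupLieAlgebra 𝓘(ℝ, E) G →L[ℝ] GroupLieAlgebra 𝓘(ℝ, E) G :=
  mfderiv 𝓘(ℝ, E) 𝓘(ℝ, E) (fun x : G ↦ a * x * a⁻¹) 1

/-- `b` is an `Ad(G)`-invariant inner product on the Lie algebra of `G`. -/
structure IsAdInvariantInner (b : LinearMap.BilinForm ℝ (GroupLieAlgebra 𝓘(ℝ, E) G)) : Prop where
  symm : ∀ X Y, b X Y = b Y X
  pos : ∀ X, X ≠ 0 → 0 < b X X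
  invariant : ∀ (a : G) X Y, b (adjointRep a X) (adjointRep a Y) = b X Y

/-- `m₁ = h^⊥ ∩ k`. -/
def verticalSpace (b : LinearMap.BilinForm ℝ (GroupLieAlgebra 𝓘(ℝ, E) G)) (H K : Subgroup G) :
    Submodule ℝ (GroupLieAlgebra 𝓘(ℝ, E) G) :=
  b.orthogonal (subgroupLieAlgebra H) ⊓ subgroupLieAlgebra K

/-- `m₂ = k^⊥`. -/
def horizontalSpace (b : LinearMap.BilinForm ℝ (GroupLieAlgebra 𝓘(ℝ, E) G)) (K : Subgroup G) :
    Submodule ℝ (GroupLieAlgebra 𝓘(ℝ, E) G) :=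
  b.orthogonal (subgroupLieAlgebra K)

/-- The base point `o = eH` of `G/H`. -/
def basePoint (H : Subgroup G) : G ⧸ H := ((1 : G) : G ⧸ H)

variable {EM : Type*} [NormedAddCommGroup EM] [NormedSpace ℝ EM]
  {H : Subgroup G} [ChartedSpace EM (G ⧸ H)]

/-- The vector field `X^*` on `G/H` induced by `X` in the Lie algebra of `G`:
`X^*_p = d/dt|_{t=0} exp(tX) • p`, the image of `X` under the differential at `1` of `a ↦ a • p`. -/
def inducedField (X : GroupLieAlgebra 𝓘(ℝ, E) G) (p : G ⧸ H) : TangentSpace 𝓘(ℝ, EM) p :=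
  mfderiv 𝓘(ℝ, E) 𝓘(ℝ, EM) (fun a : G ↦ a • p) 1 X

variable [IsManifold 𝓘(ℝ, EM) ∞ (G ⧸ H)]

/-- `g` is the canonical variation with parameter `lam`: the `G`-invariant metric on `G/H` that is
given on `T_o(G/H) ≅ m = m₁ ⊕ m₂` by `lam * b(X_{m₁}, Y_{m₁}) + b(X_{m₂}, Y_{m₂})`. -/
structure IsCanonicalVariation (b : LinearMap.BilinForm ℝ (GroupLieAlgebra 𝓘(ℝ, E) G))
    (K : Subgroup G) (lam : ℝ) (g : SmoothMetric 𝓘(ℝ, EM) (G ⧸ H)) : Prop where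
  invariant : ∀ (a : G) (p : G ⧸ H) (u v : TangentSpace 𝓘(ℝ, EM) p),
    g.inner (a • p) (mfderiv 𝓘(ℝ, EM) 𝓘(ℝ, EM) (fun q : G ⧸ H ↦ a • q) p u)
      (mfderiv 𝓘(ℝ, EM) 𝓘(ℝ, EM) (fun q : G ⧸ H ↦ a • q) p v) = g.inner p u v
  apply_base : ∀ X₁ ∈ verticalSpace b H K, ∀ Y₁ ∈ verticalSpace b H K,
    ∀ X₂ ∈ horizontalSpace b K, ∀ Y₂ ∈ horizontalSpace b K,
      g.inner (basePoint H) (inducedField (X₁ + X₂) (basePoint H))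
        (inducedField (Y₁ + Y₂) (basePoint H)) = lam * b X₁ Y₁ + b X₂ Y₂

/-- The inclusion `K/H → G/H`, `kH ↦ kH`, of the fiber through `o`. -/
def fiberInclusion (H K : Subgroup G) : K ⧸ H.subgroupOf K → G ⧸ H :=
  Quotient.map' (fun k : K ↦ (k : G)) fun k l h ↦ by
    rw [QuotientGroup.leftRel_apply] at h ⊢
    exact h

variable {EF : Type*} [NormedAddCommGroup EF] [NormedSpace ℝ EF]
  {K : Subgroup G} [ChartedSpace EF (K ⧸ H.subgroupOf K)]
  [IsManifold 𝓘(ℝ, EF) ∞ (K ⧸ H.subgroupOf K)]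

/-- `gF` is the metric induced on the fiber `K/H` by the metric `g` of `G/H`. -/
def IsInducedMetric (g : SmoothMetric 𝓘(ℝ, EM) (G ⧸ H))
    (gF : SmoothMetric 𝓘(ℝ, EF) (K ⧸ H.subgroupOf K)) : Prop :=
  ∀ (q : K ⧸ H.subgroupOf K) (u v : TangentSpace 𝓘(ℝ, EF) q),
    gF.inner q u v = g.inner (fiberInclusion H K q)
      (mfderiv 𝓘(ℝ, EF) 𝓘(ℝ, EM) (fiberInclusion H K) q u)
      (mfderiv 𝓘(ℝ, EF) 𝓘(ℝ, EM) (fiberInclusion H K) q v)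

/-- `V` is the restriction of `X` to the fiber `K/H`. -/
def IsRestrictionToFiber (X : Π p : G ⧸ H, TangentSpace 𝓘(ℝ, EM) p)
    (V : Π q : K ⧸ H.subgroupOf K, TangentSpace 𝓘(ℝ, EF) q) : Prop :=
  ∀ q, mfderiv 𝓘(ℝ, EF) 𝓘(ℝ, EM) (fiberInclusion H K) q (V q) = X (fiberInclusion H K q)
end HomogeneousFibration
end

/-!
Write `o` for the base point and `α` for the metric dual of `ξ^*`. The field `ξ^*` is a Killing
field, so `∇ξ^*` is skew-symmetric, and it vanishes at `o` as soon as its skew part, the exterior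
derivative `dα`, vanishes at `o`.

For a `G`-invariant metric with form `C(X, Y) = ⟨X^*_o, Y^*_o⟩` on `𝔤`, the value of `dα` on `Y^*_o`
and `Z^*_o` is `C([ξ, Y], Z) - C([ξ, Z], Y) - C(ξ, [Y, Z])`
(`inner_leviCivita_inducedField_sub`). No exponential map is used: the bracket enters as
the derivative at `1` of `a ↦ Ad(a⁻¹) Y` (`adInvDeriv`), and only its bilinearity, its antisymmetry,
its skewness for `b`, and the closedness of `𝔨` under it are needed.

Exterior derivatives restrict to submanifolds, so the hypothesis on the fiber says that `dα`
vanishes at `o` on `m₁` for the parameter `λ`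
(`SmoothMetric.inner_leviCivita_sub_of_isometric`). On `m₁` the form `C` is `λ b`, and skewness
reduces the formula to `λ b([ξ, Y], Z)`, so that `[ξ, m₁]` is orthogonal to `m₁`
(`adInvDeriv_apply_vertical_eq_zero`), a condition without `λ`.

For the parameter `2` the formula then gives `dα = 0` at `o`
(`inner_leviCivita_inducedField_sub_eq_zero`). On `m₁ × m₁` this is the condition just
found, on `m₁ × m₂` it follows from skewness and `[ξ, m₁] ⊆ 𝔨`, and on `m₂ × m₂` the first two terms
are `b([ξ, Y], Z) - b([ξ, Z], Y) = 2 b(ξ, [Y, Z])`, which cancels `C(ξ, [Y, Z])` exactly for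
the parameter `2`.
-/

open scoped Topology

noncomputable section

/-! ### Coordinate vector fields -/

/-- Leibniz rule for the evaluation of a linear form depending on a parameter, when its derivative
is only known pointwise. The map `A'` is then automatically linear. -/
theorem hasDerivAt_linearMap_apply {V : Type*} [NormedAddCommGroup V] [NormedSpace ℝ V]
    [FiniteDimensional ℝ V] {A : ℝ → V →ₗ[ℝ] ℝ} {A' : V → ℝ} {t : ℝ}
    (hA : ∀ v, HasDerivAt (fun s ↦ A s v) (A' v) t) {c : ℝ → V} {c' : V} (hc : HasDerivAt c c' t) :
    HasDerivAt (fun s ↦ A s (c s)) (A' (c t) + A t c') t := by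
  let b := Module.finBasis ℝ V
  have hcoord (i) : HasDerivAt (fun s ↦ b.coord i (c s)) (b.coord i c') t :=
    (b.coord i).toContinuousLinearMap.hasFDerivAt.comp_hasDerivAt t hc
  have key (s : ℝ) (v : V) : A s v = ∑ i, b.coord i v * A s (b i) := by
    conv_lhs => rw [← b.sum_repr v, map_sum]
    simp only [map_smul, smul_eq_mul, Module.Basis.coord_apply]
  have key' (v : V) : A' v = ∑ i, b.coord i v * A' (b i) := by
    refine (hA v).unique ?_
    simp only [key _ v]
    exact HasDerivAt.fun_sum fun i _ ↦ (hA (b i)).const_mul _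
  have h := HasDerivAt.fun_sum (u := Finset.univ) fun i _ ↦ (hcoord i).mul (hA (b i))
  refine (h.congr_deriv ?_).congr_of_eventuallyEq (.of_forall fun s ↦ key s (c s))
  rw [key' (c t), key t c', ← Finset.sum_add_distrib]
  exact Finset.sum_congr rfl fun i _ ↦ by ring

section CoordinateFields
variable {E : Type*} [NormedAddCommGroup E] [NormedSpace ℝ E]
  {M : Type*} [TopologicalSpace M] [ChartedSpace E M]
  {E' : Type*} [NormedAddCommGroup E'] [NormedSpace ℝ E']

/-- The vector field on a normed space with constant value `v`. -/
def constField (v : E) (x : E) : TangentSpace 𝓘(ℝ, E) x := v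

theorem mdiffAt_constField (v x : E) : MDiffAt (T% (constField v)) x :=
  (contMDiffAt_vectorSpace_iff_contDiffAt.2
    (contDiffAt_const (n := 1) (c := v))).mdifferentiableAt one_ne_zero

/-- The vector field that has the constant value `v` in the chart at `p`. -/
def coordField (p : M) (v : E) : Π q : M, TangentSpace 𝓘(ℝ, E) q :=
  mpullback 𝓘(ℝ, E) 𝓘(ℝ, E) (extChartAt 𝓘(ℝ, E) p) (constField v)

theorem coordField_add (p : M) (v w : E) (q : M) :
    coordField p (v + w) q = coordField p v q + coordField p w q :=
  map_add _ _ _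

theorem coordField_smul (p : M) (c : ℝ) (v : E) (q : M) :
    coordField p (c • v) q = c • coordField p v q :=
  map_smul _ _ _

variable [IsManifold 𝓘(ℝ, E) ∞ M]

/-- Every vector over the chart domain at `p` is the value of the coordinate field of its
coordinate expression. -/
theorem coordField_mfderiv_extChartAt {p q : M} (hq : q ∈ (extChartAt 𝓘(ℝ, E) p).source)
    (u : TangentSpace 𝓘(ℝ, E) q) :
    coordField (E := E) p (mfderiv 𝓘(ℝ, E) 𝓘(ℝ, E) (extChartAt 𝓘(ℝ, E) p) q u) q = u := by
  have h := isInvertible_mfderiv_extChartAt (I := 𝓘(ℝ, E)) hq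
  exact congrArg (fun L : TangentSpace 𝓘(ℝ, E) q →L[ℝ] TangentSpace 𝓘(ℝ, E) q ↦ L u)
    h.inverse_comp_self

theorem mdiffAt_coordField [CompleteSpace E] (p : M) (v : E) :
    MDiffAt (T% (coordField p v)) p :=
  (mdiffAt_constField v _).mpullback_vectorField (n := 2) contMDiffAt_extChartAt
    (isInvertible_mfderiv_extChartAt (mem_extChartAt_source p)) le_rfl

/-- The chain rule, with the derivative of `s` read in a fixed chart of the target. -/
theorem mfderiv_eq_coordField {p : M} {s : E' → M} {e : E'} (hs : MDiffAt s e)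
    (he : s e ∈ (extChartAt 𝓘(ℝ, E) p).source) (w : E') :
    mfderiv 𝓘(ℝ, E') 𝓘(ℝ, E) s e w =
      coordField p (fderiv ℝ (extChartAt 𝓘(ℝ, E) p ∘ s) e w) (s e) := by
  have h := mfderiv_comp_apply e (mdifferentiableAt_extChartAt (I := 𝓘(ℝ, E)) (x := p)
    (y := s e) (by simpa using he)) hs w
  rw [mfderiv_eq_fderiv] at h
  exact (coordField_mfderiv_extChartAt he _).symm.trans
    (congrArg (fun v : E ↦ coordField p v (s e)) h.symm)

theorem mlieBracket_eq_fderiv (V W : E → E) (x : E) :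
    mlieBracket 𝓘(ℝ, E) (V : Π x : E, TangentSpace 𝓘(ℝ, E) x) W x =
      (fderiv ℝ W x (V x) - fderiv ℝ V x (W x) : E) := by
  refine (congrFun (mlieBracketWithin_univ (I := 𝓘(ℝ, E))).symm x).trans ?_
  refine (congrFun mlieBracketWithin_eq_lieBracketWithin x).trans ?_
  exact congrFun (lieBracketWithin_univ (V := V) (W := W)) x

/-- The bracket of a coordinate field with a field whose coordinate expression is `f`
is given by the derivative of `f`. -/
theorem mlieBracket_coordField_left [CompleteSpace E] {p : M} {f : E → E}
    {X : Π q : M, TangentSpace 𝓘(ℝ, E) q}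
    (hf : ContDiffAt ℝ 1 f (extChartAt 𝓘(ℝ, E) p p))
    (hX : ∀ᶠ q in 𝓝 p, X q = coordField p (f (extChartAt 𝓘(ℝ, E) p q)) q) (v : E) :
    mlieBracket 𝓘(ℝ, E) (coordField p v) X p =
      coordField p (fderiv ℝ f (extChartAt 𝓘(ℝ, E) p p) v) p := by
  have : IsManifold 𝓘(ℝ, E) (minSmoothness ℝ 2) M := .of_le (n := ∞) (by simp; norm_cast)
  let F : Π x : E, TangentSpace 𝓘(ℝ, E) x := f
  have hF : MDiffAt (T% F) (extChartAt 𝓘(ℝ, E) p p) :=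
    (contMDiffAt_vectorSpace_iff_contDiffAt.2 hf).mdifferentiableAt one_ne_zero
  have hX' : X =ᶠ[𝓝 p] mpullback 𝓘(ℝ, E) 𝓘(ℝ, E) (extChartAt 𝓘(ℝ, E) p) F := hX
  refine (Filter.EventuallyEq.mlieBracket_vectorField_eq Filter.EventuallyEq.rfl hX').trans ?_
  refine (mpullback_mlieBracket (n := 2) (mdiffAt_constField v _) hF
    (contMDiffAt_extChartAt (I := 𝓘(ℝ, E)) (x := p)) (by simp)).symm.trans ?_
  have h := mlieBracket_eq_fderiv (fun _ ↦ v) f (extChartAt 𝓘(ℝ, E) p p)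
  rw [fderiv_fun_const, Pi.zero_apply, _root_.zero_apply, sub_zero] at h
  exact congrArg (fun u : E ↦ coordField p u p) h

theorem mlieBracket_coordField [CompleteSpace E] (p : M) (v w : E) :
    mlieBracket 𝓘(ℝ, E) (coordField p v) (coordField p w) p = 0 := by
  rw [mlieBracket_coordField_left (f := fun _ ↦ w) contDiffAt_const (.of_forall fun _ ↦ rfl)]
  simp only [fderiv_fun_const, Pi.zero_apply, _root_.zero_apply]
  exact map_zero _

end CoordinateFields

/-! ### The exterior derivative of the metric dual of a vector field -/

namespace SmoothMetric
section
variable {E : Type*} [NormedAddCommGroup E] [NormedSpace ℝ E]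
  {M : Type*} [TopologicalSpace M] [ChartedSpace E M] [IsManifold 𝓘(ℝ, E) ∞ M]
  {E' : Type*} [NormedAddCommGroup E'] [NormedSpace ℝ E']

theorem hasDerivAt_pair_comp (g : SmoothMetric 𝓘(ℝ, E) M) {X Y : Π q : M, TangentSpace 𝓘(ℝ, E) q}
    {s : E' → M} {e : E'} (hs : MDiffAt s e) (hX : MDiffAt (T% X) (s e))
    (hY : MDiffAt (T% Y) (s e)) (u : E') :
    HasDerivAt (fun t : ℝ ↦ pair g X Y (s (e + t • u)))
      (d% (pair g X Y) (s e) (mfderiv 𝓘(ℝ, E') 𝓘(ℝ, E) s e u)) 0 := by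
  have h1 : DifferentiableAt ℝ (pair g X Y ∘ s) e :=
    mdifferentiableAt_iff_differentiableAt.1 ((pair_mdiff g hX hY).comp e hs)
  have h2 := h1.hasFDerivAt.hasLineDerivAt u
  have h3 := mvfderiv_comp_apply e (pair_mdiff g hX hY) hs u
  rw [← h3]
  refine h2.congr_deriv ?_
  exact congrArg (fun L : E' →L[ℝ] ℝ ↦ L u) mfderiv_eq_fderiv.symm

variable [FiniteDimensional ℝ E]

/-- The derivative, in the direction `u`, of the function `e ↦ ⟨X, ∂_w s⟩` along a map `s`. -/
theorem hasDerivAt_inner_mfderiv (g : SmoothMetric 𝓘(ℝ, E) M)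
    {X : Π q : M, TangentSpace 𝓘(ℝ, E) q}
    {s : E' → M} {e : E'} (hs : CMDiffAt 2 s e) (hX : MDiffAt (T% X) (s e)) (u w : E') :
    HasDerivAt (fun t : ℝ ↦ g.inner (s (e + t • u)) (X (s (e + t • u)))
        (mfderiv 𝓘(ℝ, E') 𝓘(ℝ, E) s (e + t • u) w))
      (d% (pair g X (coordField (s e) (fderiv ℝ (extChartAt 𝓘(ℝ, E) (s e) ∘ s) e w))) (s e)
          (mfderiv 𝓘(ℝ, E') 𝓘(ℝ, E) s e u) +
        g.inner (s e) (X (s e)) (coordField (s e)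
          (fderiv ℝ (fderiv ℝ (extChartAt 𝓘(ℝ, E) (s e) ∘ s)) e u w) (s e))) 0 := by
  have := FiniteDimensional.complete ℝ E
  set p := s e with hp
  set σ := extChartAt 𝓘(ℝ, E) p ∘ s with hσ
  have hσ2 : ContDiffAt ℝ 2 σ e :=
    contMDiffAt_iff_contDiffAt.1 (contMDiffAt_extChartAt.comp e hs)
  have hline : Filter.Tendsto (fun t : ℝ ↦ e + t • u) (𝓝 0) (𝓝 e) :=
    Continuous.tendsto' (by fun_prop) _ _ (by simp)
  let A (t : ℝ) : E →ₗ[ℝ] ℝ :=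
    { toFun v := pair g X (coordField p v) (s (e + t • u))
      map_add' v w := by simp [pair, coordField_add]
      map_smul' c v := by simp [pair, coordField_smul] }
  have hA (v : E) : HasDerivAt (fun t ↦ A t v) _ 0 :=
    hasDerivAt_pair_comp g (hs.mdifferentiableAt (by simp)) hX (mdiffAt_coordField p v) u
  have hc : HasDerivAt (fun t : ℝ ↦ fderiv ℝ σ (e + t • u) w) (fderiv ℝ (fderiv ℝ σ) e u w) 0 := by
    have h1 : DifferentiableAt ℝ (fderiv ℝ σ) e :=
      (hσ2.fderiv_right (m := 1) (by norm_num)).differentiableAt one_ne_zero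
    have h2 : HasDerivAt (fun t : ℝ ↦ fderiv ℝ σ (e + t • u)) (fderiv ℝ (fderiv ℝ σ) e u) 0 :=
      h1.hasFDerivAt.hasLineDerivAt u
    simpa using h2.clm_apply (hasDerivAt_const 0 w)
  refine ((hasDerivAt_linearMap_apply hA hc).congr_of_eventuallyEq ?_).congr_deriv ?_
  · have h1 : ∀ᶠ e' in 𝓝 e, MDiffAt s e' := by
      filter_upwards [(contMDiffAt_iff_contMDiffAt_nhds (by simp)).1 hs] with e' he'
      exact he'.mdifferentiableAt (by simp)
    have h2 : ∀ᶠ e' in 𝓝 e, s e' ∈ (extChartAt 𝓘(ℝ, E) p).source :=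
      hs.continuousAt.eventually (extChartAt_source_mem_nhds p)
    filter_upwards [hline.eventually h1, hline.eventually h2] with t ht1 ht2
    rw [mfderiv_eq_coordField ht1 ht2]
    rfl
  · have h (e' : E') (he' : e' = e) (v : E) : g.inner (s e') (X (s e')) (coordField p v (s e')) =
        g.inner p (X p) (coordField p v p) := by subst he'; rfl
    have h' := h (e + (0 : ℝ) • u) (by simp) (fderiv ℝ (fderiv ℝ σ) e u w)
    simp only [A, LinearMap.coe_mk, AddHom.coe_mk, pair, zero_smul, add_zero] at h' ⊢
    rw [h']

/-- For a vector field `X` with metric dual `α` and a parametrized piece `s` of `M`,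
`∂_u (α (∂_w s)) - ∂_w (α (∂_u s)) = ⟨∇_{∂_u s} X, ∂_w s⟩ - ⟨∇_{∂_w s} X, ∂_u s⟩`:
both sides express the exterior derivative of `α`. -/
theorem exists_hasDerivAt_inner_mfderiv (g : SmoothMetric 𝓘(ℝ, E) M)
    {X : Π q : M, TangentSpace 𝓘(ℝ, E) q}
    {s : E' → M} {e : E'} (hs : CMDiffAt 2 s e) (hX : MDiffAt (T% X) (s e)) (u w : E') :
    ∃ a c : ℝ,
      HasDerivAt (fun t : ℝ ↦ g.inner (s (e + t • u)) (X (s (e + t • u)))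
        (mfderiv 𝓘(ℝ, E') 𝓘(ℝ, E) s (e + t • u) w)) a 0 ∧
      HasDerivAt (fun t : ℝ ↦ g.inner (s (e + t • w)) (X (s (e + t • w)))
        (mfderiv 𝓘(ℝ, E') 𝓘(ℝ, E) s (e + t • w) u)) c 0 ∧
      a - c =
        g.inner (s e) (leviCivita g X (s e) (mfderiv 𝓘(ℝ, E') 𝓘(ℝ, E) s e u))
          (mfderiv 𝓘(ℝ, E') 𝓘(ℝ, E) s e w) -
        g.inner (s e) (leviCivita g X (s e) (mfderiv 𝓘(ℝ, E') 𝓘(ℝ, E) s e w))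
          (mfderiv 𝓘(ℝ, E') 𝓘(ℝ, E) s e u) := by
  have := FiniteDimensional.complete ℝ E
  refine ⟨_, _, hasDerivAt_inner_mfderiv g hs hX u w, hasDerivAt_inner_mfderiv g hs hX w u, ?_⟩
  have hsymm : IsSymmSndFDerivAt ℝ (extChartAt 𝓘(ℝ, E) (s e) ∘ s) e :=
    (contMDiffAt_iff_contDiffAt.1 (contMDiffAt_extChartAt.comp e hs)).isSymmSndFDerivAt (by simp)
  rw [hsymm.eq u w]
  have hs1 : MDiffAt s e := hs.mdifferentiableAt (by simp)
  have hsrc := mem_extChartAt_source (I := 𝓘(ℝ, E)) (s e)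
  rw [mfderiv_eq_coordField hs1 hsrc u, mfderiv_eq_coordField hs1 hsrc w]
  set v := fderiv ℝ (extChartAt 𝓘(ℝ, E) (s e) ∘ s) e u
  set v' := fderiv ℝ (extChartAt 𝓘(ℝ, E) (s e) ∘ s) e w
  have hv := mdiffAt_coordField (s e) v
  have hv' := mdiffAt_coordField (s e) v'
  have htor := leviCivita_torsion g hv hv'
  rw [mlieBracket_coordField, sub_eq_zero] at htor
  rw [leviCivita_metric g hv hX hv', leviCivita_metric g hv' hX hv, htor]
  ring

end
end SmoothMetric

/-! ### The action on the quotient -/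

section Submersion
variable {E : Type*} [NormedAddCommGroup E] [NormedSpace ℝ E]
  {E' : Type*} [NormedAddCommGroup E'] [NormedSpace ℝ E']
  {M : Type*} [TopologicalSpace M] [ChartedSpace E M]
  {N : Type*} [TopologicalSpace N] [ChartedSpace E' N]

/-- In charts where `f` is a linear projection, a section is given by freezing the complementary
coordinate. -/
theorem Manifold.IsSubmersionAt.exists_local_section {f : M → N} {x : M}
    (hf : Manifold.IsSubmersionAt 𝓘(ℝ, E) 𝓘(ℝ, E') ∞ f x) :
    ∃ s : N → M, CMDiffAt ∞ s (f x) ∧ s (f x) = x ∧ ∀ᶠ y in 𝓝 (f x), f (s y) = y := by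
  obtain ⟨F, _, _, h⟩ := hf
  set φ := h.domChart
  set ψ := h.codChart
  have hx : x ∈ φ.source := h.mem_domChart_source
  have hfx : f x ∈ ψ.source := h.mem_codChart_source
  have hw (z : E) (hz : z ∈ φ.target) : ψ (f (φ.symm z)) = (h.equiv z).1 := by
    have hz' : z ∈ (h.domChart.extend 𝓘(ℝ, E)).target := by simpa [φ] using hz
    have := h.writtenInCharts hz'
    simpa [φ, ψ] using this
  let r (y : N) : E := h.equiv.symm (ψ y, (h.equiv (φ x)).2)
  have hrx : r (f x) = φ x := by
    have h1 := hw (φ x) (φ.map_source hx)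
    rw [φ.left_inv hx] at h1
    simp [r, h1]
  have hψ : CMDiffAt ∞ ψ (f x) :=
    (contMDiffOn_of_mem_maximalAtlas h.codChart_mem_maximalAtlas).contMDiffAt
      (ψ.open_source.mem_nhds hfx)
  have hr : CMDiffAt ∞ r (f x) := by
    have h1 : ContDiff ℝ ∞ fun z : E' ↦ h.equiv.symm (z, (h.equiv (φ x)).2) := by fun_prop
    exact h1.contMDiff.contMDiffAt.comp (f x) hψ
  have hφ : CMDiffAt ∞ φ.symm (r (f x)) := by
    rw [hrx]
    exact (contMDiffOn_symm_of_mem_maximalAtlas h.domChart_mem_maximalAtlas).contMDiffAt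
      (φ.open_target.mem_nhds (φ.map_source hx))
  refine ⟨φ.symm ∘ r, hφ.comp (f x) hr, by simp [hrx, φ.left_inv hx], ?_⟩
  have h1 : ∀ᶠ y in 𝓝 (f x), r y ∈ φ.target :=
    hr.continuousAt.eventually
      (φ.open_target.mem_nhds (by rw [hrx]; exact φ.map_source hx))
  filter_upwards [h1, ψ.open_source.mem_nhds hfx] with y hy1 hy2
  refine ψ.injOn (h.mapsto_domChart_source_codChart_source (φ.map_target hy1)) hy2 ?_
  exact (hw _ hy1).trans (by simp [r])

end Submersion

section Action
variable {E : Type*} [NormedAddCommGroup E] [NormedSpace ℝ E]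
  {G : Type*} [Group G] [TopologicalSpace G] [ChartedSpace E G] [LieGroup 𝓘(ℝ, E) ∞ G]
  {EM : Type*} [NormedAddCommGroup EM] [NormedSpace ℝ EM]
  {H : Subgroup G} [ChartedSpace EM (G ⧸ H)]

/-- If `G → G/H` is a submersion, the action of `G` on `G/H` is smooth: it lifts to the
multiplication of `G` through local sections. -/
theorem contMDiff_smul_quotient
    (hproj : Manifold.IsSubmersion 𝓘(ℝ, E) 𝓘(ℝ, EM) ∞ (fun a : G ↦ (a : G ⧸ H))) :
    ContMDiff (𝓘(ℝ, E).prod 𝓘(ℝ, EM)) 𝓘(ℝ, EM) ∞ (fun z : G × (G ⧸ H) ↦ z.1 • z.2) := by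
  rintro ⟨a, p⟩
  obtain ⟨x, rfl⟩ := QuotientGroup.mk_surjective p
  obtain ⟨s, hs, -, hsec⟩ := (hproj.isSubmersionAt x).exists_local_section
  have h1 : ContMDiffAt (𝓘(ℝ, E).prod 𝓘(ℝ, EM)) 𝓘(ℝ, EM) ∞
      (fun z : G × (G ⧸ H) ↦ ((z.1 * s z.2 : G) : G ⧸ H)) (a, (x : G ⧸ H)) :=
    hproj.contMDiff.contMDiffAt.comp _ (contMDiffAt_fst.mul
      (ContMDiffAt.comp (a, (x : G ⧸ H)) hs contMDiffAt_snd))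
  refine h1.congr_of_eventuallyEq ?_
  filter_upwards [continuous_snd.continuousAt.eventually hsec] with z hz
  conv_lhs => rw [← hz]
  rfl

omit [TopologicalSpace G] in
theorem smul_basePoint (a : G) : a • basePoint H = (a : G ⧸ H) :=
  congrArg (fun b : G ↦ (b : G ⧸ H)) (mul_one a)

omit [LieGroup 𝓘(ℝ, E) ∞ G] in
/-- The map `X ↦ X^*_o` is onto `T_o(G/H)`. -/
theorem exists_inducedField_basePoint_eq
    (hproj : Manifold.IsSubmersion 𝓘(ℝ, E) 𝓘(ℝ, EM) ∞ (fun a : G ↦ (a : G ⧸ H)))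
    (v : TangentSpace 𝓘(ℝ, EM) (basePoint H)) :
    ∃ X : GroupLieAlgebra 𝓘(ℝ, E) G, inducedField X (basePoint H) = v := by
  obtain ⟨s, hs, hs1, hsec⟩ := (hproj.isSubmersionAt 1).exists_local_section
  refine ⟨mfderiv 𝓘(ℝ, EM) 𝓘(ℝ, E) s (basePoint H) v, ?_⟩
  have h1 : (fun a : G ↦ a • basePoint H) = fun a : G ↦ (a : G ⧸ H) := funext smul_basePoint
  unfold inducedField
  rw [h1]
  refine (mfderiv_comp_apply_of_eq (basePoint H) (y := (1 : G))
    (hproj.contMDiff.mdifferentiableAt (by simp)) (hs.mdifferentiableAt (by simp)) hs1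
    v).symm.trans ?_
  have h2 : (fun a : G ↦ (a : G ⧸ H)) ∘ s =ᶠ[𝓝 (basePoint H)] id := hsec
  rw [h2.mfderiv_eq, mfderiv_id]
  rfl

omit [LieGroup 𝓘(ℝ, E) ∞ G] in
theorem contMDiff_smul_const (hA : ContMDiff (𝓘(ℝ, E).prod 𝓘(ℝ, EM)) 𝓘(ℝ, EM) ∞
      (fun z : G × (G ⧸ H) ↦ z.1 • z.2)) (p : G ⧸ H) :
    ContMDiff 𝓘(ℝ, E) 𝓘(ℝ, EM) ∞ (fun a : G ↦ a • p) :=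
  hA.comp (contMDiff_id.prodMk contMDiff_const)

omit [LieGroup 𝓘(ℝ, E) ∞ G] in
theorem contMDiff_const_smul (hA : ContMDiff (𝓘(ℝ, E).prod 𝓘(ℝ, EM)) 𝓘(ℝ, EM) ∞
      (fun z : G × (G ⧸ H) ↦ z.1 • z.2)) (a : G) :
    ContMDiff 𝓘(ℝ, EM) 𝓘(ℝ, EM) ∞ (fun p : G ⧸ H ↦ a • p) :=
  hA.comp (contMDiff_const.prodMk contMDiff_id)

theorem contMDiff_conj (a : G) : ContMDiff 𝓘(ℝ, E) 𝓘(ℝ, E) ∞ (fun x : G ↦ a * x * a⁻¹) :=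
  (contMDiff_const.mul contMDiff_id).mul contMDiff_const

/-- Translations map induced fields to induced fields: `a_* X^* = (Ad(a) X)^*`. -/
theorem mfderiv_smul_inducedField (hA : ContMDiff (𝓘(ℝ, E).prod 𝓘(ℝ, EM)) 𝓘(ℝ, EM) ∞
      (fun z : G × (G ⧸ H) ↦ z.1 • z.2)) (a : G) (X : GroupLieAlgebra 𝓘(ℝ, E) G) (p : G ⧸ H) :
    mfderiv 𝓘(ℝ, EM) 𝓘(ℝ, EM) (fun q : G ⧸ H ↦ a • q) p (inducedField X p) =
      inducedField (EM := EM) (adjointRep a X) (a • p) := by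
  have h1 := mfderiv_comp_apply_of_eq (1 : G) (y := p)
    ((contMDiff_const_smul hA a).mdifferentiableAt (by simp))
    ((contMDiff_smul_const hA p).mdifferentiableAt (by simp)) (one_smul G p) X
  have h2 := mfderiv_comp_apply_of_eq (1 : G) (y := (1 : G))
    ((contMDiff_smul_const hA (a • p)).mdifferentiableAt (by simp))
    ((contMDiff_conj (E := E) a).mdifferentiableAt (by simp)) (by simp) X
  have h3 : (fun q : G ⧸ H ↦ a • q) ∘ (fun e : G ↦ e • p) =
      (fun e : G ↦ e • a • p) ∘ fun x : G ↦ a * x * a⁻¹ := by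
    funext e
    simp [smul_smul]
  rw [h3] at h1
  exact h1.symm.trans h2

/-- `X^*_p` is the image of the smooth family of vectors `(X, 0)` at `(1, p)` under the tangent map
of the action. -/
theorem contMDiff_inducedField [IsManifold 𝓘(ℝ, EM) ∞ (G ⧸ H)]
    (hA : ContMDiff (𝓘(ℝ, E).prod 𝓘(ℝ, EM)) 𝓘(ℝ, EM) ∞
      (fun z : G × (G ⧸ H) ↦ z.1 • z.2)) (X : GroupLieAlgebra 𝓘(ℝ, E) G) :
    CMDiff ∞ (T% (inducedField (EM := EM) (H := H) X)) := by
  let f₁ : G ⧸ H → TangentBundle 𝓘(ℝ, E) G := fun _ ↦ TotalSpace.mk' E (1 : G) X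
  have hf₁ : CMDiff ∞ f₁ := contMDiff_const
  let f₂ : G ⧸ H → TangentBundle 𝓘(ℝ, EM) (G ⧸ H) := fun p ↦ TotalSpace.mk' EM p 0
  have hf₂ : CMDiff ∞ f₂ := contMDiff_zeroSection _ _
  have hS : CMDiff ∞ (tangentMap (𝓘(ℝ, E).prod 𝓘(ℝ, EM)) 𝓘(ℝ, EM)
      (fun z : G × (G ⧸ H) ↦ z.1 • z.2)) :=
    hA.contMDiff_tangentMap (m := ∞) (by simp)
  have h := (hS.comp contMDiff_equivTangentBundleProd_symm).comp (hf₁.prodMk hf₂)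
  convert! h using 1
  funext p
  let v : TangentSpace (𝓘(ℝ, E).prod 𝓘(ℝ, EM)) ((1 : G), p) := Prod.mk (α := E) (β := EM) X 0
  have h1 := mfderiv_prod_eq_add_apply (v := v)
    (hA.mdifferentiableAt (x := ((1 : G), p)) (by simp))
  have h2 (q : G ⧸ H) (hq : q = p) (v : EM) :
    (TotalSpace.mk' EM p v : TangentBundle 𝓘(ℝ, EM) (G ⧸ H)) = TotalSpace.mk' EM q v := by
    subst hq; rfl
  refine (h2 ((1 : G) • p) (one_smul G p) _).trans ?_
  refine congrArg (fun v : EM ↦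
    (TotalSpace.mk' EM ((1 : G) • p) v : TangentBundle 𝓘(ℝ, EM) (G ⧸ H))) ?_
  refine Eq.trans ?_ h1.symm
  have h3 (x y z : EM) (hy : y = x) (hz : z = 0) : x = y + z := by rw [hy, hz, add_zero]
  exact h3 _ _ _ rfl
    (map_zero (mfderiv 𝓘(ℝ, EM) 𝓘(ℝ, EM) (fun q : G ⧸ H ↦ (1 : G) • q) p))

end Action

/-! ### Killing fields -/

section
variable {E : Type*} [NormedAddCommGroup E] [NormedSpace ℝ E]
  {M : Type*} [TopologicalSpace M] [ChartedSpace E M] [IsManifold 𝓘(ℝ, E) ∞ M]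

theorem contMDiffAt_extChartAt_symm_self (p : M) :
    ContMDiffAt 𝓘(ℝ, E) 𝓘(ℝ, E) ∞ (extChartAt 𝓘(ℝ, E) p).symm (extChartAt 𝓘(ℝ, E) p p) :=
  (contMDiffOn_extChartAt_symm p).contMDiffAt (extChartAt_target_mem_nhds p)

theorem mfderiv_extChartAt_symm_self (p : M) (v : E) :
    mfderiv 𝓘(ℝ, E) 𝓘(ℝ, E) (extChartAt 𝓘(ℝ, E) p).symm (extChartAt 𝓘(ℝ, E) p p) v =
      (v : E) := by
  have h := mfderivWithin_range_extChartAt_symm (I := 𝓘(ℝ, E)) (x := p)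
  rw [modelWithCornersSelf_coe, Set.range_id, mfderivWithin_univ] at h
  exact congrArg (fun L : E →L[ℝ] E ↦ L v) h

omit [IsManifold 𝓘(ℝ, E) ∞ M] in
/-- Tangent spaces at equal points are not syntactically equal, hence the comparison in `E`. -/
theorem coordField_congr_point (p : M) (v : E) {q q' : M} (h : q = q') :
    (coordField p v q : E) = coordField p v q' := by
  subst h; rfl

theorem coordField_self (p : M) (v : E) : coordField p v p = (v : E) := by
  have h := coordField_mfderiv_extChartAt (mem_extChartAt_source (I := 𝓘(ℝ, E)) p)
    (v : TangentSpace 𝓘(ℝ, E) p)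
  rw [mfderiv_extChartAt_self] at h
  exact h

end

namespace SmoothMetric
section
variable {E : Type*} [NormedAddCommGroup E] [NormedSpace ℝ E] [FiniteDimensional ℝ E]
  {M : Type*} [TopologicalSpace M] [ChartedSpace E M] [IsManifold 𝓘(ℝ, E) ∞ M]

/-- The derivative of the square norm of a vector along a curve, in terms of the coordinate
expression `c` of the vector. -/
theorem hasDerivAt_pair_coordField (g : SmoothMetric 𝓘(ℝ, E) M) {p : M} {γ : ℝ → M}
    (hγ : MDiffAt γ 0) (hγ0 : γ 0 = p) {c : ℝ → E} {v c' : E} (hc : HasDerivAt c c' 0)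
    (hc0 : c 0 = v) :
    HasDerivAt (fun t ↦ pair g (coordField p (c t)) (coordField p (c t)) (γ t))
      (d% (pair g (coordField p v) (coordField p v)) p (mfderiv 𝓘(ℝ, ℝ) 𝓘(ℝ, E) γ 0 (1 : ℝ)) +
        2 * g.inner p (coordField p c' p) (coordField p v p)) 0 := by
  have := FiniteDimensional.complete ℝ E
  subst hγ0 hc0
  let A (w : E) (t : ℝ) : E →ₗ[ℝ] ℝ :=
    { toFun u := pair g (coordField (γ 0) u) (coordField (γ 0) w) (γ t)
      map_add' u v := by simp [pair, coordField_add]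
      map_smul' c v := by simp [pair, coordField_smul] }
  have hA (w u : E) : HasDerivAt (fun t ↦ A w t u)
      (d% (pair g (coordField (γ 0) u) (coordField (γ 0) w)) (γ 0)
        (mfderiv 𝓘(ℝ, ℝ) 𝓘(ℝ, E) γ 0 (1 : ℝ))) 0 := by
    have h := hasDerivAt_pair_comp g hγ (mdiffAt_coordField (γ 0) u)
      (mdiffAt_coordField (γ 0) w) (1 : ℝ)
    simp only [zero_add, smul_eq_mul, mul_one] at h
    exact h
  let B (t : ℝ) : E →ₗ[ℝ] ℝ :=
    { toFun w := A w t (c t)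
      map_add' u v := by simp [A, pair, coordField_add]
      map_smul' c v := by simp [A, pair, coordField_smul] }
  have hB (w : E) : HasDerivAt (fun t ↦ B t w) _ 0 := hasDerivAt_linearMap_apply (hA w) hc
  refine (hasDerivAt_linearMap_apply hB hc).congr_deriv ?_
  simp only [A, B, LinearMap.coe_mk, AddHom.coe_mk, pair]
  rw [g.symm _ (coordField (γ 0) (c 0) (γ 0))]
  ring

/-- Let `Φ` be a smooth family of isometries with `Φ 0 = id` and velocity field `X` at `t = 0`.
Then `⟨∇_w X, w⟩ = 0`. -/
theorem inner_leviCivita_self_eq_zero (g : SmoothMetric 𝓘(ℝ, E) M)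
    {X : Π q : M, TangentSpace 𝓘(ℝ, E) q} {Φ : ℝ → M → M} (hΦ0 : ∀ q, Φ 0 q = q)
    (hΦ : ∀ q, ContMDiffAt (𝓘(ℝ, ℝ).prod 𝓘(ℝ, E)) 𝓘(ℝ, E) 2 (fun z : ℝ × M ↦ Φ z.1 z.2) (0, q))
    (hΦd : ∀ t, MDiff (Φ t))
    (hΦX : ∀ q, (mfderiv 𝓘(ℝ, ℝ) 𝓘(ℝ, E) (fun t ↦ Φ t q) 0 (1 : ℝ) : E) = X q)
    (hiso : ∀ t q (u : TangentSpace 𝓘(ℝ, E) q), g.inner (Φ t q)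
      (mfderiv 𝓘(ℝ, E) 𝓘(ℝ, E) (Φ t) q u) (mfderiv 𝓘(ℝ, E) 𝓘(ℝ, E) (Φ t) q u) = g.inner q u u)
    {p : M} (hX : MDiffAt (T% X) p) (w : TangentSpace 𝓘(ℝ, E) p) :
    g.inner p (leviCivita g X p w) w = 0 := by
  have := FiniteDimensional.complete ℝ E
  set φ := extChartAt 𝓘(ℝ, E) p with hφ
  set x₀ := φ p with hx₀
  have hψx₀ : φ.symm x₀ = p := extChartAt_to_inv p
  let v : E := w
  have hvw : coordField p v p = w := coordField_self p v
  let σ : ℝ × E → E := fun z ↦ φ (Φ z.1 (φ.symm z.2))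
  have hΨ : ContMDiffAt 𝓘(ℝ, ℝ × E) 𝓘(ℝ, E) 2 (fun z : ℝ × E ↦ Φ z.1 (φ.symm z.2)) (0, x₀) := by
    have h1 : ContMDiffAt 𝓘(ℝ, ℝ × E) (𝓘(ℝ, ℝ).prod 𝓘(ℝ, E)) 2
        (fun z : ℝ × E ↦ (z.1, φ.symm z.2)) (0, x₀) := by
      refine ContMDiffAt.prodMk contDiff_fst.contMDiff.contMDiffAt ?_
      exact ContMDiffAt.comp (0, x₀)
        ((contMDiffAt_extChartAt_symm_self p).of_le (by norm_cast))
        contDiff_snd.contMDiff.contMDiffAt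
    have h2 := hΦ p
    rw [← hψx₀] at h2
    exact ContMDiffAt.comp (0, x₀) h2 h1
  have hΨ0 : (fun z : ℝ × E ↦ Φ z.1 (φ.symm z.2)) (0, x₀) = p := by
    simp only [hψx₀, hΦ0]
  have hσ : ContDiffAt ℝ 2 σ (0, x₀) := by
    have h1 : ContMDiffAt 𝓘(ℝ, E) 𝓘(ℝ, E) 2 φ p := contMDiffAt_extChartAt
    rw [← hΨ0] at h1
    exact contMDiffAt_iff_contDiffAt.1 (ContMDiffAt.comp (0, x₀) h1 hΨ)
  have hσ' : ContDiffAt ℝ 1 (fderiv ℝ σ) (0, x₀) := hσ.fderiv_right (by norm_num)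
  have hσ'd := (hσ'.differentiableAt one_ne_zero).hasFDerivAt
  have hev : ∀ᶠ z in 𝓝 (0, x₀),
      MDifferentiableAt 𝓘(ℝ, ℝ × E) 𝓘(ℝ, E) (fun z : ℝ × E ↦ Φ z.1 (φ.symm z.2)) z ∧
      DifferentiableAt ℝ σ z ∧ Φ z.1 (φ.symm z.2) ∈ φ.source := by
    filter_upwards [(contMDiffAt_iff_contMDiffAt_nhds (by simp)).1 hΨ, hσ.eventually (by simp),
      hΨ.continuousAt.eventually
        (by rw [hΨ0]; exact extChartAt_source_mem_nhds (I := 𝓘(ℝ, E)) p)] with z h1 h2 h3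
    exact ⟨h1.mdifferentiableAt (by simp), h2.differentiableAt (by simp), h3⟩
  -- `f` is the coordinate expression of `X`
  let f : E → E := fun x ↦ fderiv ℝ σ (0, x) (1, 0)
  have hf : ContDiffAt ℝ 1 f x₀ := by
    have h1 : ContDiffAt ℝ 1 (fun x : E ↦ fderiv ℝ σ (0, x)) x₀ :=
      ContDiffAt.comp x₀ hσ' (by fun_prop)
    exact h1.clm_apply contDiffAt_const
  have hXf : ∀ᶠ q in 𝓝 p, X q = coordField p (f (φ q)) q := by
    have h1 : ContinuousAt (fun q ↦ ((0 : ℝ), φ q)) p :=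
      continuousAt_const.prodMk (continuousAt_extChartAt p)
    filter_upwards [h1.eventually hev, extChartAt_source_mem_nhds (I := 𝓘(ℝ, E)) p] with q hq hqs
    have hMq : MDiffAt (fun t ↦ Φ t q) (0 : ℝ) :=
      (((hΦ q).comp 0 (contMDiffAt_id.prodMk contMDiffAt_const)) : ContMDiffAt 𝓘(ℝ, ℝ) 𝓘(ℝ, E) 2
        (fun t ↦ Φ t q) (0 : ℝ)).mdifferentiableAt (by simp)
    have h2 := mfderiv_eq_coordField (p := p) hMq (by rw [hΦ0]; exact hqs) (1 : ℝ)
    have h3 : φ ∘ (fun t ↦ Φ t q) = fun t ↦ σ (t, φ q) := by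
      funext t; simp [σ, φ.left_inv hqs]
    have h4 : fderiv ℝ (fun t ↦ σ (t, φ q)) 0 1 = f (φ q) := by
      have h5 : HasFDerivAt (fun t : ℝ ↦ (t, φ q)) (ContinuousLinearMap.inl ℝ ℝ E) 0 :=
        hasFDerivAt_prodMk_left _ _
      have h6 := HasFDerivAt.comp (g := σ) (0 : ℝ) hq.2.1.hasFDerivAt h5
      refine (congrArg (fun L : ℝ →L[ℝ] E ↦ L 1) h6.fderiv).trans ?_
      simp [f]
    rw [h3, h4] at h2
    refine (hΦX q).symm.trans (h2.trans ?_)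
    exact coordField_congr_point p _ (hΦ0 q)
  -- `c t` is the coordinate expression of the image of `w` under `Φ t`
  let c : ℝ → E := fun t ↦ fderiv ℝ σ (t, x₀) (0, v)
  have hc : HasDerivAt c (fderiv ℝ (fderiv ℝ σ) (0, x₀) (1, 0) (0, v)) 0 := by
    have h1 : HasDerivAt (fun t : ℝ ↦ (t, x₀)) ((1 : ℝ), (0 : E)) 0 :=
      (hasDerivAt_id _).prodMk (hasDerivAt_const _ _)
    have h2 : HasDerivAt (fun t : ℝ ↦ fderiv ℝ σ (t, x₀))
        (fderiv ℝ (fderiv ℝ σ) (0, x₀) (1, 0)) 0 := hσ'd.comp_hasDerivAt 0 h1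
    simpa using h2.clm_apply (hasDerivAt_const 0 ((0 : ℝ), v))
  have hfv : fderiv ℝ f x₀ v = fderiv ℝ (fderiv ℝ σ) (0, x₀) (1, 0) (0, v) := by
    have h1 : HasFDerivAt (fun x : E ↦ ((0 : ℝ), x)) (ContinuousLinearMap.inr ℝ ℝ E) x₀ :=
      hasFDerivAt_prodMk_right _ _
    have h2 : HasFDerivAt (fun x : E ↦ fderiv ℝ σ (0, x)) _ x₀ := hσ'd.comp x₀ h1
    have h3 := (h2.clm_apply (hasFDerivAt_const ((1 : ℝ), (0 : E)) x₀)).fderiv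
    have h4 := (hσ.isSymmSndFDerivAt (by simp)).eq (1, 0) (0, v)
    rw [h4]
    change fderiv ℝ (fun x : E ↦ fderiv ℝ σ (0, x) (1, 0)) x₀ v = _
    rw [h3]
    simp
  have hΦt : ∀ᶠ t in 𝓝 (0 : ℝ), pair g (coordField p (c t)) (coordField p (c t)) (Φ t p) =
      g.inner p w w := by
    have h1 : ContinuousAt (fun t : ℝ ↦ (t, x₀)) 0 := by fun_prop
    filter_upwards [h1.eventually hev] with t ht
    have h2 : HasFDerivAt (fun x : E ↦ (t, x)) (ContinuousLinearMap.inr ℝ ℝ E) x₀ :=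
      hasFDerivAt_prodMk_right _ _
    have h3 := HasFDerivAt.comp (g := σ) x₀ ht.2.1.hasFDerivAt h2
    have h4 : MDiffAt φ.symm x₀ :=
      (contMDiffAt_extChartAt_symm_self p).mdifferentiableAt (by simp)
    have h5 := mfderiv_comp_apply_of_eq x₀ (hΦd t p) h4 hψx₀ v
    have h6 := mfderiv_eq_coordField (p := p) ((hΦd t _).comp x₀ h4) ht.2.2 v
    have h7 : fderiv ℝ (φ ∘ Φ t ∘ φ.symm) x₀ v = c t := by
      refine (congrArg (fun L : E →L[ℝ] E ↦ L v) h3.fderiv).trans ?_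
      simp [c]
    have h8 : (mfderiv 𝓘(ℝ, E) 𝓘(ℝ, E) φ.symm x₀ v : E) = v := mfderiv_extChartAt_symm_self p v
    have h9 : mfderiv 𝓘(ℝ, E) 𝓘(ℝ, E) (Φ t) p w = coordField p (c t) (Φ t p) := by
      refine Eq.trans ?_ (h5.symm.trans (h6.trans ?_))
      · exact congrArg (fun u : E ↦ (mfderiv 𝓘(ℝ, E) 𝓘(ℝ, E) (Φ t) p u : E)) h8.symm
      · rw [h7]
        exact coordField_congr_point p _ (congrArg (Φ t) hψx₀)
    rw [pair, ← h9, hiso]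
  have hc0 : c 0 = v := by
    have h2 : HasFDerivAt (fun x : E ↦ ((0 : ℝ), x)) (ContinuousLinearMap.inr ℝ ℝ E) x₀ :=
      hasFDerivAt_prodMk_right _ _
    have h3 := HasFDerivAt.comp (g := σ) x₀ hev.self_of_nhds.2.1.hasFDerivAt h2
    have h4 : HasFDerivAt (σ ∘ fun x : E ↦ ((0 : ℝ), x)) (ContinuousLinearMap.id ℝ E) x₀ := by
      refine (hasFDerivAt_id x₀).congr_of_eventuallyEq ?_
      filter_upwards [extChartAt_target_mem_nhds (I := 𝓘(ℝ, E)) p] with x hx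
      simp only [σ, Function.comp_apply, hΦ0]
      exact φ.right_inv hx
    simpa [c] using congrArg (fun L : E →L[ℝ] E ↦ L v) (h3.unique h4)
  have hγ : MDiffAt (fun t ↦ Φ t p) (0 : ℝ) :=
    (((hΦ p).comp 0 (contMDiffAt_id.prodMk contMDiffAt_const)) : ContMDiffAt 𝓘(ℝ, ℝ) 𝓘(ℝ, E) 2
      (fun t ↦ Φ t p) (0 : ℝ)).mdifferentiableAt (by simp)
  have hd := (hasDerivAt_pair_coordField g hγ (hΦ0 p) hc hc0).unique
    ((hasDerivAt_const 0 (g.inner p w w)).congr_of_eventuallyEq hΦt)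
  have hγX : mfderiv 𝓘(ℝ, ℝ) 𝓘(ℝ, E) (fun t ↦ Φ t p) 0 (1 : ℝ) = (X p : E) := hΦX p
  have hU := mdiffAt_coordField p v
  have hbr := mlieBracket_coordField_left hf hXf v
  rw [← leviCivita_torsion g hU hX] at hbr
  have hmet := leviCivita_metric g hX hU hU
  have hd' : d% (pair g (coordField p v) (coordField p v)) p (X p) +
      2 * g.inner p (coordField p (fderiv ℝ f x₀ v) p) (coordField p v p) = 0 := by
    rw [hfv]
    refine Eq.trans ?_ hd
    refine congrArg (· + _) ?_
    exact congrArg (fun u : E ↦ d% (pair g (coordField p v) (coordField p v)) p u) hγX.symm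
  rw [hmet, ← hbr, hvw, g.symm p w] at hd'
  simp only [map_sub, _root_.sub_apply] at hd'
  linarith

/-- A smooth field with skew-symmetric covariant derivative is a Killing field. -/
theorem isKilling_of_inner_leviCivita_self_eq_zero (g : SmoothMetric 𝓘(ℝ, E) M)
    {X : Π q : M, TangentSpace 𝓘(ℝ, E) q} (hX : CMDiff ∞ (T% X))
    (hskew : ∀ p (w : TangentSpace 𝓘(ℝ, E) p), g.inner p (leviCivita g X p w) w = 0) :
    IsKilling g X := by
  refine ⟨hX, fun Y Z hY hZ p ↦ ?_⟩
  have hX' := hX.mdifferentiableAt (x := p) (by simp)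
  have hY' := hY.mdifferentiableAt (x := p) (by simp)
  have hZ' := hZ.mdifferentiableAt (x := p) (by simp)
  rw [leviCivita_metric g hX' hY' hZ', ← leviCivita_torsion g hX' hY',
    ← leviCivita_torsion g hX' hZ']
  have h := hskew p (Y p + Z p)
  simp only [map_add, _root_.add_apply, hskew, zero_add, add_zero] at h
  simp only [map_sub, _root_.sub_apply]
  rw [g.symm p (Y p) (leviCivita g X p (Z p))]
  linarith

end
end SmoothMetric

/-! ### Induced fields are Killing fields -/

section ChartCurve
variable {E : Type*} [NormedAddCommGroup E] [NormedSpace ℝ E]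
  {G : Type*} [Group G] [TopologicalSpace G] [ChartedSpace E G]

/-- The curve through `1` in `G` that is a line with velocity `x` in the chart at `1`. -/
def chartCurve (G : Type*) [Group G] [TopologicalSpace G] [ChartedSpace E G] (x : E) (t : ℝ) : G :=
  (extChartAt 𝓘(ℝ, E) (1 : G)).symm (extChartAt 𝓘(ℝ, E) (1 : G) 1 + t • x)

theorem chartCurve_zero (x : E) : chartCurve G x 0 = 1 := by
  simp only [chartCurve, zero_smul, add_zero]
  exact extChartAt_to_inv (1 : G)

variable [LieGroup 𝓘(ℝ, E) ∞ G]

theorem contMDiffAt_chartCurve (x : E) :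
    ContMDiffAt 𝓘(ℝ, ℝ) 𝓘(ℝ, E) ∞ (chartCurve G x) 0 := by
  have hφ : ContMDiffAt 𝓘(ℝ, E) 𝓘(ℝ, E) ∞ (extChartAt 𝓘(ℝ, E) (1 : G)).symm
      (extChartAt 𝓘(ℝ, E) (1 : G) 1 + (0 : ℝ) • x) := by
    rw [zero_smul, add_zero]
    exact contMDiffAt_extChartAt_symm_self (1 : G)
  exact ContMDiffAt.comp (0 : ℝ) hφ (contMDiffAt_iff_contDiffAt.2 (by fun_prop))

theorem mfderiv_chartCurve (x : E) :
    mfderiv 𝓘(ℝ, ℝ) 𝓘(ℝ, E) (chartCurve G x) 0 (1 : ℝ) = x := by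
  set φ := extChartAt 𝓘(ℝ, E) (1 : G)
  have hl : HasFDerivAt (fun t : ℝ ↦ φ 1 + t • x) (ContinuousLinearMap.toSpanSingleton ℝ x) 0 :=
    ((ContinuousLinearMap.toSpanSingleton ℝ x).hasFDerivAt).const_add (φ 1)
  have h1 := mfderiv_comp_apply_of_eq (g := φ.symm) (0 : ℝ) (y := φ 1)
    ((contMDiffAt_extChartAt_symm_self (1 : G)).mdifferentiableAt (by simp))
    hl.differentiableAt.mdifferentiableAt (by simp) (1 : ℝ)
  refine h1.trans ((mfderiv_extChartAt_symm_self (1 : G) _).trans ?_)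
  have h3 : mfderiv 𝓘(ℝ, ℝ) 𝓘(ℝ, E) (fun t : ℝ ↦ φ 1 + t • x) 0 =
      ContinuousLinearMap.toSpanSingleton ℝ x := mfderiv_eq_fderiv.trans hl.fderiv
  exact (congrArg (fun L : ℝ →L[ℝ] E ↦ L 1) h3).trans (one_smul ℝ x)

end ChartCurve

section Killing
variable {E : Type*} [NormedAddCommGroup E] [NormedSpace ℝ E]
  {G : Type*} [Group G] [TopologicalSpace G] [ChartedSpace E G] [LieGroup 𝓘(ℝ, E) ∞ G]
  {EM : Type*} [NormedAddCommGroup EM] [NormedSpace ℝ EM] [FiniteDimensional ℝ EM]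
  {H : Subgroup G} [ChartedSpace EM (G ⧸ H)] [IsManifold 𝓘(ℝ, EM) ∞ (G ⧸ H)]

/-- For a `G`-invariant metric the fields induced by the action are Killing fields. -/
theorem inner_leviCivita_inducedField_self
    (hA : ContMDiff (𝓘(ℝ, E).prod 𝓘(ℝ, EM)) 𝓘(ℝ, EM) ∞ (fun z : G × (G ⧸ H) ↦ z.1 • z.2))
    (g : SmoothMetric 𝓘(ℝ, EM) (G ⧸ H))
    (hg : ∀ (a : G) (p : G ⧸ H) (u v : TangentSpace 𝓘(ℝ, EM) p),
      g.inner (a • p) (mfderiv 𝓘(ℝ, EM) 𝓘(ℝ, EM) (fun q : G ⧸ H ↦ a • q) p u)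
        (mfderiv 𝓘(ℝ, EM) 𝓘(ℝ, EM) (fun q : G ⧸ H ↦ a • q) p v) = g.inner p u v)
    (X : GroupLieAlgebra 𝓘(ℝ, E) G) (p : G ⧸ H) (w : TangentSpace 𝓘(ℝ, EM) p) :
    g.inner p (SmoothMetric.leviCivita g (inducedField X) p w) w = 0 := by
  let γ : ℝ → G := chartCurve (E := E) G X
  have hγ0 : γ 0 = 1 := chartCurve_zero (E := E) X
  have hγ : ContMDiffAt 𝓘(ℝ, ℝ) 𝓘(ℝ, E) ∞ γ 0 := contMDiffAt_chartCurve (E := E) X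
  refine SmoothMetric.inner_leviCivita_self_eq_zero g (Φ := fun t q ↦ γ t • q)
    (fun q ↦ by simp [hγ0]) (fun q ↦ ?_) (fun t ↦ ?_) (fun q ↦ ?_)
    (fun t q u ↦ hg (γ t) q u u)
    ((contMDiff_inducedField hA X).mdifferentiableAt (by simp)) w
  · have h1 : ContMDiffAt (𝓘(ℝ, ℝ).prod 𝓘(ℝ, EM)) (𝓘(ℝ, E).prod 𝓘(ℝ, EM)) ∞
        (fun z : ℝ × (G ⧸ H) ↦ (γ z.1, z.2)) (0, q) :=
      (ContMDiffAt.comp (g := γ) ((0 : ℝ), q) hγ contMDiffAt_fst).prodMk contMDiffAt_snd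
    exact (hA.contMDiffAt.comp ((0 : ℝ), q) h1).of_le (by norm_cast)
  · exact (contMDiff_const_smul hA (γ t)).mdifferentiable (by simp)
  · have h1 := mfderiv_comp_apply_of_eq (0 : ℝ) (y := (1 : G))
      ((contMDiff_smul_const hA q).mdifferentiableAt (by simp))
      (hγ.mdifferentiableAt (by simp)) hγ0 (1 : ℝ)
    refine h1.trans ?_
    exact congrArg (fun u : E ↦
      (mfderiv 𝓘(ℝ, E) 𝓘(ℝ, EM) (fun a : G ↦ a • q) 1 u : EM)) (mfderiv_chartCurve (E := E) X)

end Killing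

/-! ### The bracket as derivative of the adjoint representation -/

theorem hasDerivAt_bilin_apply {V : Type*} [NormedAddCommGroup V] [NormedSpace ℝ V]
    [FiniteDimensional ℝ V] (b : V →ₗ[ℝ] V →ₗ[ℝ] ℝ) {u v : ℝ → V} {u' v' : V} {t : ℝ}
    (hu : HasDerivAt u u' t) (hv : HasDerivAt v v' t) :
    HasDerivAt (fun s ↦ b (u s) (v s)) (b u' (v t) + b (u t) v') t := by
  refine hasDerivAt_linearMap_apply (A := fun s ↦ b (u s)) (A' := fun w ↦ b u' w)
    (fun w ↦ ?_) hv
  exact (b.flip w).toContinuousLinearMap.hasFDerivAt.comp_hasDerivAt t hu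

/-- Let `m` be a product with unit `x₀` in coordinates, and `c` the conjugation given by
`m (y, x) = m (x, c (x, y))`. The mixed second derivative of `c` is the skew part of that
of `m`. -/
theorem fderiv_fderiv_conj_skew {E : Type*} [NormedAddCommGroup E] [NormedSpace ℝ E]
    {m c : E × E → E} {x₀ : E} (hm : ContDiffAt ℝ 2 m (x₀, x₀)) (hc : ContDiffAt ℝ 2 c (x₀, x₀))
    (hm0 : ∀ᶠ y in 𝓝 x₀, m (x₀, y) = y) (hc0 : ∀ x, c (x, x₀) = x₀)
    (hc1 : ∀ᶠ y in 𝓝 x₀, c (x₀, y) = y)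
    (hmc : ∀ᶠ z in 𝓝 (x₀, x₀), m (z.2, z.1) = m (z.1, c z)) (Y Z : E) :
    fderiv ℝ (fderiv ℝ c) (x₀, x₀) (Y, 0) (0, Z) =
      - fderiv ℝ (fderiv ℝ c) (x₀, x₀) (Z, 0) (0, Y) := by
  have key (Y Z : E) : fderiv ℝ (fderiv ℝ m) (x₀, x₀) (0, Y) (Z, 0) =
      fderiv ℝ (fderiv ℝ m) (x₀, x₀) (Y, 0) (0, Z) +
        fderiv ℝ (fderiv ℝ c) (x₀, x₀) (Y, 0) (0, Z) := by
    have hdiff {f : E × E → E} (hf : ContDiffAt ℝ 2 f (x₀, x₀)) :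
        HasFDerivAt (fderiv ℝ f) (fderiv ℝ (fderiv ℝ f) (x₀, x₀)) (x₀, x₀) :=
      ((hf.fderiv_right (m := 1) (by norm_num)).differentiableAt one_ne_zero).hasFDerivAt
    have hev {f : E × E → E} (hf : ContDiffAt ℝ 2 f (x₀, x₀)) :
        ∀ᶠ z in 𝓝 (x₀, x₀), DifferentiableAt ℝ f z :=
      (hf.eventually (by simp)).mono fun z hz ↦ hz.differentiableAt (by simp)
    have hl : Filter.Tendsto (fun t : ℝ ↦ x₀ + t • Y) (𝓝 0) (𝓝 x₀) :=
      Continuous.tendsto' (by fun_prop) _ _ (by simp)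
    have hlc (c' : E) : HasDerivAt (fun t : ℝ ↦ x₀ + t • Y) Y 0 := by
      simpa using ((hasDerivAt_id (0 : ℝ)).smul_const Y).const_add x₀
    -- first-order identity in the second variable
    have h1 : ∀ᶠ x in 𝓝 x₀, fderiv ℝ m (x₀, x) (Z, 0) =
        fderiv ℝ m (x, x₀) (0, fderiv ℝ c (x, x₀) (0, Z)) := by
      have t1 : Filter.Tendsto (fun x : E ↦ (x₀, x)) (𝓝 x₀) (𝓝 (x₀, x₀)) :=
        Continuous.tendsto' (by fun_prop) _ _ rfl
      have t2 : Filter.Tendsto (fun x : E ↦ (x, x₀)) (𝓝 x₀) (𝓝 (x₀, x₀)) :=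
        Continuous.tendsto' (by fun_prop) _ _ rfl
      filter_upwards [t1.eventually (hev hm), t2.eventually (hev hm), t2.eventually (hev hc),
        t2.eventually hmc.eventually_nhds] with x h1 h2 h3 h4
      have e1 : HasFDerivAt (fun y : E ↦ m (y, x)) _ x₀ :=
        HasFDerivAt.comp (g := m) x₀ h1.hasFDerivAt (hasFDerivAt_prodMk_left x₀ x)
      have e2 : HasFDerivAt (fun y : E ↦ c (x, y)) _ x₀ :=
        HasFDerivAt.comp (g := c) x₀ h3.hasFDerivAt (hasFDerivAt_prodMk_right x x₀)
      have e3 : HasFDerivAt m (fderiv ℝ m (x, x₀)) (x, c (x, x₀)) := by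
        rw [hc0]; exact h2.hasFDerivAt
      have e4 : HasFDerivAt (fun y : E ↦ m (x, c (x, y))) _ x₀ :=
        HasFDerivAt.comp (g := m) x₀ e3 ((hasFDerivAt_const x x₀).prodMk e2)
      have e5 : (fun y : E ↦ m (y, x)) =ᶠ[𝓝 x₀] fun y ↦ m (x, c (x, y)) :=
        (Continuous.tendsto' (by fun_prop) _ _ rfl :
          Filter.Tendsto (fun y : E ↦ (x, y)) (𝓝 x₀) (𝓝 (x, x₀))).eventually h4
      simpa using congrArg (fun L : E →L[ℝ] E ↦ L Z) (e1.unique (e4.congr_of_eventuallyEq e5))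
    have hlY := hlc Y
    have p1 : HasDerivAt (fun t : ℝ ↦ (x₀, x₀ + t • Y)) ((0 : E), Y) 0 :=
      (hasDerivAt_const _ _).prodMk hlY
    have p2 : HasDerivAt (fun t : ℝ ↦ (x₀ + t • Y, x₀)) (Y, (0 : E)) 0 :=
      hlY.prodMk (hasDerivAt_const _ _)
    have hz : x₀ + (0 : ℝ) • Y = x₀ := by simp
    have d1 : HasDerivAt (fun t : ℝ ↦ fderiv ℝ m (x₀, x₀ + t • Y)) _ 0 :=
      HasFDerivAt.comp_hasDerivAt (f := fun t : ℝ ↦ (x₀, x₀ + t • Y)) 0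
        (by rw [hz]; exact hdiff hm) p1
    have d2 : HasDerivAt (fun t : ℝ ↦ fderiv ℝ m (x₀ + t • Y, x₀)) _ 0 :=
      HasFDerivAt.comp_hasDerivAt (f := fun t : ℝ ↦ (x₀ + t • Y, x₀)) 0
        (by rw [hz]; exact hdiff hm) p2
    have d3 : HasDerivAt (fun t : ℝ ↦ fderiv ℝ c (x₀ + t • Y, x₀)) _ 0 :=
      HasFDerivAt.comp_hasDerivAt (f := fun t : ℝ ↦ (x₀ + t • Y, x₀)) 0
        (by rw [hz]; exact hdiff hc) p2
    have d4 := d1.clm_apply (hasDerivAt_const 0 (Z, (0 : E)))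
    have d5 := d2.clm_apply ((hasDerivAt_const 0 (0 : E)).prodMk
      (d3.clm_apply (hasDerivAt_const 0 ((0 : E), Z))))
    have d6 := d4.unique (d5.congr_of_eventuallyEq (hl.eventually h1))
    have hm0' (W : E) : fderiv ℝ m (x₀, x₀) (0, W) = W := by
      have e1 : HasFDerivAt (fun y : E ↦ m (x₀, y)) _ x₀ :=
        HasFDerivAt.comp (g := m) x₀ (hev hm).self_of_nhds.hasFDerivAt
          (hasFDerivAt_prodMk_right x₀ x₀)
      have e2 : HasFDerivAt (fun y : E ↦ m (x₀, y)) (ContinuousLinearMap.id ℝ E) x₀ :=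
        (hasFDerivAt_id x₀).congr_of_eventuallyEq hm0
      simpa using congrArg (fun L : E →L[ℝ] E ↦ L W) (e1.unique e2)
    have hc0' : fderiv ℝ c (x₀, x₀) (0, Z) = Z := by
      have e1 : HasFDerivAt (fun y : E ↦ c (x₀, y)) _ x₀ :=
        HasFDerivAt.comp (g := c) x₀ (hev hc).self_of_nhds.hasFDerivAt
          (hasFDerivAt_prodMk_right x₀ x₀)
      have e2 : HasFDerivAt (fun y : E ↦ c (x₀, y)) (ContinuousLinearMap.id ℝ E) x₀ :=
        (hasFDerivAt_id x₀).congr_of_eventuallyEq hc1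
      simpa using congrArg (fun L : E →L[ℝ] E ↦ L Z) (e1.unique e2)
    simpa [hz, hm0', hc0'] using d6
  have hs := (hm.isSymmSndFDerivAt (by simp)).eq
  have h1 := key Y Z
  have h2 := key Z Y
  rw [hs (0, Y) (Z, 0)] at h1
  rw [hs (0, Z) (Y, 0), h1] at h2
  rw [eq_neg_iff_add_eq_zero]
  rw [add_assoc] at h2
  exact add_eq_left.1 h2.symm

section
variable {E : Type*} [NormedAddCommGroup E] [NormedSpace ℝ E]
  {G : Type*} [Group G] [TopologicalSpace G] [ChartedSpace E G]

/-- The derivative of `a ↦ Ad(a⁻¹) Y` at `1` in the direction `X`, that is `-[X, Y]`. It is taken in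
the chart at `1`, which identifies the tangent space at `1` with the model space. -/
def adInvDeriv (X Y : GroupLieAlgebra 𝓘(ℝ, E) G) : GroupLieAlgebra 𝓘(ℝ, E) G :=
  fderiv ℝ (F := E) (fun x : E ↦ adjointRep ((extChartAt 𝓘(ℝ, E) (1 : G)).symm x)⁻¹ Y)
    (extChartAt 𝓘(ℝ, E) (1 : G) 1) X

variable [LieGroup 𝓘(ℝ, E) ∞ G]

/-- The adjoint representation in the chart at `1`. -/
theorem adjointRep_eq_fderiv (a : G) (Y : E) :
    adjointRep a Y = fderiv ℝ (fun y : E ↦ extChartAt 𝓘(ℝ, E) (1 : G)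
      (a * (extChartAt 𝓘(ℝ, E) (1 : G)).symm y * a⁻¹)) (extChartAt 𝓘(ℝ, E) (1 : G) 1) Y := by
  set φ := extChartAt 𝓘(ℝ, E) (1 : G)
  have h1 := (contMDiffAt_extChartAt_symm_self (E := E) (1 : G)).mdifferentiableAt (by simp)
  have h2 : MDiffAt (fun x : G ↦ a * x * a⁻¹) 1 :=
    (contMDiff_conj (E := E) a).mdifferentiableAt (by simp)
  have h3 : MDiffAt φ (1 : G) := mdifferentiableAt_extChartAt (mem_chart_source E 1)
  have h2' : MDiffAt (fun x : G ↦ a * x * a⁻¹) (φ.symm (φ 1)) := by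
    rw [extChartAt_to_inv]; exact h2
  have e1 := mfderiv_comp_apply_of_eq (φ 1) h2 h1 (extChartAt_to_inv (1 : G)) Y
  have e2 := mfderiv_comp_apply_of_eq (φ 1) h3 (h2'.comp (φ 1) h1)
    (by simp [φ]) Y
  rw [mfderiv_eq_fderiv] at e2
  refine Eq.trans ?_ e2.symm
  refine Eq.trans ?_ (congrArg (fun L : E →L[ℝ] E ↦
    L (mfderiv 𝓘(ℝ, E) 𝓘(ℝ, E) ((fun x : G ↦ a * x * a⁻¹) ∘ φ.symm) (φ 1) Y : E))
    (mfderiv_extChartAt_self (I := 𝓘(ℝ, E)) (x := (1 : G)))).symm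
  refine Eq.trans ?_ e1.symm
  exact congrArg (fun u : E ↦ (mfderiv 𝓘(ℝ, E) 𝓘(ℝ, E) (fun x : G ↦ a * x * a⁻¹) 1 u : E))
    (mfderiv_extChartAt_symm_self (1 : G) Y).symm

/-- The map `(a, b) ↦ a⁻¹ b a` in the chart at `1`. -/
def chartConj (G : Type*) [Group G] [TopologicalSpace G] [ChartedSpace E G] (z : E × E) : E :=
  extChartAt 𝓘(ℝ, E) (1 : G) (((extChartAt 𝓘(ℝ, E) (1 : G)).symm z.1)⁻¹ *
    (extChartAt 𝓘(ℝ, E) (1 : G)).symm z.2 * (extChartAt 𝓘(ℝ, E) (1 : G)).symm z.1)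

/-- The multiplication in the chart at `1`. -/
def chartMul (G : Type*) [Group G] [TopologicalSpace G] [ChartedSpace E G] (z : E × E) : E :=
  extChartAt 𝓘(ℝ, E) (1 : G) ((extChartAt 𝓘(ℝ, E) (1 : G)).symm z.1 *
    (extChartAt 𝓘(ℝ, E) (1 : G)).symm z.2)

theorem contMDiffAt_chart_fst (G : Type*) [Group G] [TopologicalSpace G] [ChartedSpace E G]
    [LieGroup 𝓘(ℝ, E) ∞ G] :
    ContMDiffAt 𝓘(ℝ, E × E) 𝓘(ℝ, E) ∞ (fun z : E × E ↦ (extChartAt 𝓘(ℝ, E) (1 : G)).symm z.1)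
      (extChartAt 𝓘(ℝ, E) (1 : G) 1, extChartAt 𝓘(ℝ, E) (1 : G) 1) :=
  ContMDiffAt.comp (_, _) (contMDiffAt_extChartAt_symm_self (1 : G))
    contDiff_fst.contMDiff.contMDiffAt

theorem contMDiffAt_chart_snd (G : Type*) [Group G] [TopologicalSpace G] [ChartedSpace E G]
    [LieGroup 𝓘(ℝ, E) ∞ G] :
    ContMDiffAt 𝓘(ℝ, E × E) 𝓘(ℝ, E) ∞ (fun z : E × E ↦ (extChartAt 𝓘(ℝ, E) (1 : G)).symm z.2)
      (extChartAt 𝓘(ℝ, E) (1 : G) 1, extChartAt 𝓘(ℝ, E) (1 : G) 1) :=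
  ContMDiffAt.comp (_, _) (contMDiffAt_extChartAt_symm_self (1 : G))
    contDiff_snd.contMDiff.contMDiffAt

theorem contDiffAt_chartConj (G : Type*) [Group G] [TopologicalSpace G] [ChartedSpace E G]
    [LieGroup 𝓘(ℝ, E) ∞ G] :
    ContDiffAt ℝ 2 (chartConj (E := E) G)
      (extChartAt 𝓘(ℝ, E) (1 : G) 1, extChartAt 𝓘(ℝ, E) (1 : G) 1) := by
  have h1 := contMDiffAt_chart_fst (E := E) G
  have h2 := contMDiffAt_chart_snd (E := E) G
  have h3 : ContMDiffAt 𝓘(ℝ, E) 𝓘(ℝ, E) ∞ (extChartAt 𝓘(ℝ, E) (1 : G)) (1 : G) :=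
    contMDiffAt_extChartAt
  refine contMDiffAt_iff_contDiffAt.1 (ContMDiffAt.of_le (n := ∞) ?_ (by norm_cast))
  refine ContMDiffAt.comp (_, _) ?_ ((h1.inv.mul h2).mul h1)
  simpa using h3

theorem contDiffAt_chartMul (G : Type*) [Group G] [TopologicalSpace G] [ChartedSpace E G]
    [LieGroup 𝓘(ℝ, E) ∞ G] :
    ContDiffAt ℝ 2 (chartMul (E := E) G)
      (extChartAt 𝓘(ℝ, E) (1 : G) 1, extChartAt 𝓘(ℝ, E) (1 : G) 1) := by
  have h1 := contMDiffAt_chart_fst (E := E) G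
  have h2 := contMDiffAt_chart_snd (E := E) G
  have h3 : ContMDiffAt 𝓘(ℝ, E) 𝓘(ℝ, E) ∞ (extChartAt 𝓘(ℝ, E) (1 : G)) (1 : G) :=
    contMDiffAt_extChartAt
  refine contMDiffAt_iff_contDiffAt.1 (ContMDiffAt.of_le (n := ∞) ?_ (by norm_cast))
  refine ContMDiffAt.comp (_, _) ?_ (h1.mul h2)
  simpa using h3

theorem hasFDerivAt_adjointRep_inv (Y : E) :
    HasFDerivAt (F := E) (fun x : E ↦ adjointRep ((extChartAt 𝓘(ℝ, E) (1 : G)).symm x)⁻¹ Y)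
      ((ContinuousLinearMap.apply ℝ E ((0 : E), Y)).comp
        ((fderiv ℝ (fderiv ℝ (chartConj (E := E) G))
          (extChartAt 𝓘(ℝ, E) (1 : G) 1, extChartAt 𝓘(ℝ, E) (1 : G) 1)).comp
          (ContinuousLinearMap.inl ℝ E E)))
      (extChartAt 𝓘(ℝ, E) (1 : G) 1) := by
  set x₀ := extChartAt 𝓘(ℝ, E) (1 : G) 1
  have hc := contDiffAt_chartConj (E := E) G
  have h1 : HasFDerivAt (fun x : E ↦ fderiv ℝ (chartConj (E := E) G) (x, x₀)) _ x₀ :=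
    HasFDerivAt.comp (g := fderiv ℝ (chartConj (E := E) G)) x₀
      (((hc.fderiv_right (m := 1) (by norm_num)).differentiableAt one_ne_zero).hasFDerivAt)
      (hasFDerivAt_prodMk_left x₀ x₀)
  have h2 := (ContinuousLinearMap.apply ℝ E ((0 : E), Y)).hasFDerivAt.comp x₀ h1
  refine h2.congr_of_eventuallyEq ?_
  have t2 : Filter.Tendsto (fun x : E ↦ (x, x₀)) (𝓝 x₀) (𝓝 (x₀, x₀)) :=
    Continuous.tendsto' (by fun_prop) _ _ rfl
  filter_upwards [t2.eventually (hc.eventually (by simp))] with x hx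
  have h3 := HasFDerivAt.comp (g := chartConj (E := E) G) x₀
    (hx.differentiableAt (by simp)).hasFDerivAt (hasFDerivAt_prodMk_right x x₀)
  have h4 : (chartConj (E := E) G ∘ fun y : E ↦ (x, y)) = fun y : E ↦
      extChartAt 𝓘(ℝ, E) (1 : G) (((extChartAt 𝓘(ℝ, E) (1 : G)).symm x)⁻¹ *
        (extChartAt 𝓘(ℝ, E) (1 : G)).symm y * ((extChartAt 𝓘(ℝ, E) (1 : G)).symm x)⁻¹⁻¹) := by
    funext y
    simp [chartConj]
  rw [h4] at h3
  refine (adjointRep_eq_fderiv _ Y).trans ?_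
  refine (congrArg (fun L : E →L[ℝ] E ↦ L Y) h3.fderiv).trans ?_
  simp

theorem adInvDeriv_eq_fderiv_chartConj (X Y : E) :
    adInvDeriv (G := G) X Y = fderiv ℝ (fderiv ℝ (chartConj (E := E) G))
      (extChartAt 𝓘(ℝ, E) (1 : G) 1, extChartAt 𝓘(ℝ, E) (1 : G) 1)
      (X, (0 : E)) ((0 : E), Y) := by
  have h := (hasFDerivAt_adjointRep_inv (E := E) (G := G) Y).fderiv
  exact DFunLike.congr_fun h X

theorem adInvDeriv_skew (X Y : GroupLieAlgebra 𝓘(ℝ, E) G) :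
    adInvDeriv X Y = - adInvDeriv Y X := by
  set φ := extChartAt 𝓘(ℝ, E) (1 : G) with hφ
  have htgt := extChartAt_target_mem_nhds (I := 𝓘(ℝ, E)) (1 : G)
  have h1 : φ.symm (φ 1) = 1 := extChartAt_to_inv (1 : G)
  have h2 := fderiv_fderiv_conj_skew (E := E) (contDiffAt_chartMul (E := E) G)
    (contDiffAt_chartConj G)
    (by filter_upwards [htgt] with y hy
        simpa only [chartMul, ← hφ, h1, one_mul] using φ.right_inv hy)
    (fun x ↦ by simp [chartConj])
    (by filter_upwards [htgt] with y hy
        simpa only [chartConj, ← hφ, h1, inv_one, one_mul, mul_one] using φ.right_inv hy)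
    (by
      have hsrc : φ.source ∈ 𝓝 (1 : G) := extChartAt_source_mem_nhds (I := 𝓘(ℝ, E)) (1 : G)
      have hcont : ContinuousAt (fun z : E × E ↦ (φ.symm z.1)⁻¹ * φ.symm z.2 * φ.symm z.1)
          (φ 1, φ 1) :=
        (((contMDiffAt_chart_fst (E := E) G).inv.mul (contMDiffAt_chart_snd G)).mul
          (contMDiffAt_chart_fst G)).continuousAt
      have h3 := hcont.eventually (p := fun a ↦ a ∈ φ.source)
        (by simp only [h1, inv_one, mul_one]; exact hsrc)
      filter_upwards [h3] with z hz
      simp only [chartMul, chartConj, ← hφ]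
      rw [φ.left_inv hz]
      congr 1
      group)
    X Y
  exact (adInvDeriv_eq_fderiv_chartConj (E := E) X Y).trans
    (h2.trans (congrArg (fun u : E ↦ -u) (adInvDeriv_eq_fderiv_chartConj (E := E) Y X)).symm)

/-- The derivative of `t ↦ Ad(δ(t)⁻¹) Y` only depends on the velocity of `δ`. -/
theorem hasDerivAt_adjointRep_inv {δ : ℝ → G} (hδ : MDiffAt δ 0) (hδ0 : δ 0 = 1)
    {X : E} (hδX : mfderiv 𝓘(ℝ, ℝ) 𝓘(ℝ, E) δ 0 (1 : ℝ) = X) (Y : E) :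
    HasDerivAt (F := E) (fun t ↦ adjointRep (δ t)⁻¹ Y) (adInvDeriv (G := G) X Y) 0 := by
  set φ := extChartAt 𝓘(ℝ, E) (1 : G) with hφ
  have hφ1 : MDiffAt φ (1 : G) := mdifferentiableAt_extChartAt (mem_chart_source E 1)
  have hφ1' : MDiffAt φ (δ 0) := by rw [hδ0]; exact hφ1
  have h1 : DifferentiableAt ℝ (φ ∘ δ) 0 :=
    mdifferentiableAt_iff_differentiableAt.1 (hφ1'.comp (0 : ℝ) hδ)
  have h2 : deriv (φ ∘ δ) 0 = X := by
    have e1 := mfderiv_comp_apply_of_eq (0 : ℝ) hφ1 hδ hδ0 (1 : ℝ)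
    rw [mfderiv_eq_fderiv] at e1
    refine Eq.trans (e1.trans ?_) hδX
    exact congrArg (fun L : E →L[ℝ] E ↦ L (mfderiv 𝓘(ℝ, ℝ) 𝓘(ℝ, E) δ 0 (1 : ℝ) : E))
      (mfderiv_extChartAt_self (I := 𝓘(ℝ, E)) (x := (1 : G)))
  have h3 : HasDerivAt (φ ∘ δ) X 0 := h2 ▸ h1.hasDerivAt
  have h4 := HasFDerivAt.comp_hasDerivAt_of_eq (0 : ℝ)
    (hasFDerivAt_adjointRep_inv (E := E) (G := G) Y).differentiableAt.hasFDerivAt h3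
    (congrArg φ hδ0).symm
  refine h4.congr_of_eventuallyEq ?_
  have h5 : ∀ᶠ t in 𝓝 (0 : ℝ), δ t ∈ φ.source :=
    hδ.continuousAt.eventually (p := fun a ↦ a ∈ φ.source)
      (by rw [hδ0]; exact extChartAt_source_mem_nhds (I := 𝓘(ℝ, E)) (1 : G))
  filter_upwards [h5] with t ht
  exact congrArg (fun a : G ↦ (adjointRep a⁻¹ Y : E)) (φ.left_inv ht).symm

omit [LieGroup 𝓘(ℝ, E) ∞ G] in
theorem adjointRep_one (Y : GroupLieAlgebra 𝓘(ℝ, E) G) : adjointRep 1 Y = Y := by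
  have h : (fun x : G ↦ 1 * x * 1⁻¹) = id := by
    funext x
    simp
  unfold adjointRep
  rw [h]
  exact congrArg (fun L : E →L[ℝ] E ↦ L Y) (mfderiv_id (I := 𝓘(ℝ, E)) (x := (1 : G)))

/-- An `Ad`-invariant inner product makes the infinitesimal adjoint action skew-symmetric. -/
theorem IsAdInvariantInner.adInvDeriv_skew [FiniteDimensional ℝ E]
    {b : LinearMap.BilinForm ℝ (GroupLieAlgebra 𝓘(ℝ, E) G)} (hb : IsAdInvariantInner b)
    (X Y Z : GroupLieAlgebra 𝓘(ℝ, E) G) :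
    b (adInvDeriv X Y) Z + b Y (adInvDeriv X Z) = 0 := by
  have h0 := chartCurve_zero (G := G) (E := E) X
  have hd (Y : E) := hasDerivAt_adjointRep_inv (E := E) (G := G)
    ((contMDiffAt_chartCurve (G := G) (E := E) X).mdifferentiableAt (by simp)) h0
    (mfderiv_chartCurve (E := E) X) Y
  have h1 := hasDerivAt_bilin_apply (V := E) b (hd Y) (hd Z)
  have h2 : ∀ t, b (adjointRep (chartCurve (E := E) G X t)⁻¹ Y)
      (adjointRep (chartCurve (E := E) G X t)⁻¹ Z) = b Y Z := fun t ↦ hb.invariant _ _ _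
  have h3 : HasDerivAt (fun t ↦ b (adjointRep (chartCurve (E := E) G X t)⁻¹ Y)
      (adjointRep (chartCurve (E := E) G X t)⁻¹ Z)) 0 0 := by
    simp only [h2]
    exact hasDerivAt_const _ _
  have h4 : ∀ W : GroupLieAlgebra 𝓘(ℝ, E) G,
      adjointRep (chartCurve (E := E) G X 0)⁻¹ W = W := fun W ↦ by
    rw [h0, inv_one, adjointRep_one]
  have h5 := h1.unique h3
  rw [h4, h4] at h5
  exact h5

/-- The Lie algebra of `K` is preserved by `Ad(K)`. -/
theorem adjointRep_mem_subgroupLieAlgebra {K : Subgroup G} {a : G} (ha : a ∈ K)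
    {Y : GroupLieAlgebra 𝓘(ℝ, E) G} (hY : Y ∈ subgroupLieAlgebra K) :
    adjointRep a Y ∈ subgroupLieAlgebra K := by
  obtain ⟨γ, hγ, hγK, hγ0, rfl⟩ := hY
  refine ⟨fun t ↦ a * γ t * a⁻¹, (contMDiff_conj (E := E) a).comp hγ,
    fun t ↦ K.mul_mem (K.mul_mem ha (hγK t)) (K.inv_mem ha), by simp [hγ0], ?_⟩
  exact mfderiv_comp_apply_of_eq (0 : ℝ) ((contMDiff_conj (E := E) a).mdifferentiableAt (by simp))
    (hγ.mdifferentiableAt (by simp)) hγ0 (1 : ℝ)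

/-- The Lie algebra of `K` is closed under the bracket, tested against its complement. -/
theorem adInvDeriv_apply_eq_zero [FiniteDimensional ℝ E]
    (b : LinearMap.BilinForm ℝ (GroupLieAlgebra 𝓘(ℝ, E) G)) {K : Subgroup G}
    {X Y Z : GroupLieAlgebra 𝓘(ℝ, E) G} (hX : X ∈ subgroupLieAlgebra K)
    (hY : Y ∈ subgroupLieAlgebra K) (hZ : Z ∈ horizontalSpace b K) :
    b (adInvDeriv X Y) Z = 0 := by
  obtain ⟨δ, hδ, hδK, hδ0, hδX⟩ := hX
  have hd := hasDerivAt_adjointRep_inv (E := E) (hδ.mdifferentiableAt (by simp)) hδ0 hδX Y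
  have h1 := hasDerivAt_bilin_apply (V := E) b hd (hasDerivAt_const (F := E) (0 : ℝ) Z)
  have h2 : ∀ t, b (adjointRep (δ t)⁻¹ Y) Z = 0 := fun t ↦
    hZ _ (adjointRep_mem_subgroupLieAlgebra (K.inv_mem (hδK t)) hY)
  have h3 : HasDerivAt (fun t ↦ b (adjointRep (δ t)⁻¹ Y) Z) 0 0 := by
    simp only [h2]
    exact hasDerivAt_const _ _
  have h5 := h1.unique h3
  rw [map_zero, add_zero] at h5
  exact h5

end

/-! ### Exterior derivative of the metric dual of an induced field -/

section
variable {E : Type*} [NormedAddCommGroup E] [NormedSpace ℝ E]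
  {M : Type*} [TopologicalSpace M] [ChartedSpace E M]
  {E' : Type*} [NormedAddCommGroup E'] [NormedSpace ℝ E']

theorem mfderiv_prodMk_zero_left {s : E' × E' → M} {x y : E'}
    (hs : MDifferentiableAt 𝓘(ℝ, E' × E') 𝓘(ℝ, E) s (x, y)) (w : E') :
    mfderiv 𝓘(ℝ, E' × E') 𝓘(ℝ, E) s (x, y) ((0 : E'), w) =
      mfderiv 𝓘(ℝ, E') 𝓘(ℝ, E) (fun y' ↦ s (x, y')) y w := by
  have h1 : HasFDerivAt (fun y' : E' ↦ (x, y')) (ContinuousLinearMap.inr ℝ E' E') y :=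
    hasFDerivAt_prodMk_right _ _
  have h2 := mfderiv_comp_apply (g := s) y hs h1.differentiableAt.mdifferentiableAt w
  rw [mfderiv_eq_fderiv, h1.fderiv] at h2
  exact h2.symm

theorem mfderiv_prodMk_zero_right {s : E' × E' → M} {x y : E'}
    (hs : MDifferentiableAt 𝓘(ℝ, E' × E') 𝓘(ℝ, E) s (x, y)) (w : E') :
    mfderiv 𝓘(ℝ, E' × E') 𝓘(ℝ, E) s (x, y) (w, (0 : E')) =
      mfderiv 𝓘(ℝ, E') 𝓘(ℝ, E) (fun x' ↦ s (x', y)) x w := by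
  have h1 : HasFDerivAt (fun x' : E' ↦ (x', y)) (ContinuousLinearMap.inl ℝ E' E') x :=
    hasFDerivAt_prodMk_left _ _
  have h2 := mfderiv_comp_apply (g := s) x hs h1.differentiableAt.mdifferentiableAt w
  rw [mfderiv_eq_fderiv, h1.fderiv] at h2
  exact h2.symm

/-- `SmoothMetric.exists_hasDerivAt_inner_mfderiv` with the tangent
vectors seen at a point `p` equal to `s e`. -/
theorem SmoothMetric.exists_hasDerivAt_inner_mfderiv_of_eq [FiniteDimensional ℝ E]
    [IsManifold 𝓘(ℝ, E) ∞ M] (g : SmoothMetric 𝓘(ℝ, E) M)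
    {X : Π q : M, TangentSpace 𝓘(ℝ, E) q}
    {s : E' → M} {e : E'} {p : M} (hp : s e = p) (hs : CMDiffAt 2 s e) (hX : MDiffAt (T% X) p)
    {u w : E'} {u' w' : TangentSpace 𝓘(ℝ, E) p}
    (hu : (mfderiv 𝓘(ℝ, E') 𝓘(ℝ, E) s e u : E) = u')
    (hw : (mfderiv 𝓘(ℝ, E') 𝓘(ℝ, E) s e w : E) = w') :
    ∃ a c : ℝ,
      HasDerivAt (fun t : ℝ ↦ g.inner (s (e + t • u)) (X (s (e + t • u)))
        (mfderiv 𝓘(ℝ, E') 𝓘(ℝ, E) s (e + t • u) w)) a 0 ∧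
      HasDerivAt (fun t : ℝ ↦ g.inner (s (e + t • w)) (X (s (e + t • w)))
        (mfderiv 𝓘(ℝ, E') 𝓘(ℝ, E) s (e + t • w) u)) c 0 ∧
      a - c = g.inner p (leviCivita g X p u') w' - g.inner p (leviCivita g X p w') u' := by
  subst hp
  subst hu hw
  exact exists_hasDerivAt_inner_mfderiv g hs hX u w

end

section
variable {E : Type*} [NormedAddCommGroup E] [NormedSpace ℝ E]
  {G : Type*} [Group G] [TopologicalSpace G] [ChartedSpace E G] [LieGroup 𝓘(ℝ, E) ∞ G]
  {EM : Type*} [NormedAddCommGroup EM] [NormedSpace ℝ EM]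
  {H : Subgroup G} [ChartedSpace EM (G ⧸ H)] [IsManifold 𝓘(ℝ, EM) ∞ (G ⧸ H)]

omit [LieGroup 𝓘(ℝ, E) ∞ G] [IsManifold 𝓘(ℝ, EM) ∞ (G ⧸ H)] in
theorem inducedField_add (X Y : GroupLieAlgebra 𝓘(ℝ, E) G) (p : G ⧸ H) :
    inducedField (EM := EM) (X + Y) p = inducedField X p + inducedField Y p :=
  map_add (mfderiv 𝓘(ℝ, E) 𝓘(ℝ, EM) (fun a : G ↦ a • p) 1) X Y

omit [LieGroup 𝓘(ℝ, E) ∞ G] [IsManifold 𝓘(ℝ, EM) ∞ (G ⧸ H)] in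
theorem inducedField_smul (c : ℝ) (X : GroupLieAlgebra 𝓘(ℝ, E) G) (p : G ⧸ H) :
    inducedField (EM := EM) (c • X) p = c • inducedField X p :=
  map_smul (mfderiv 𝓘(ℝ, E) 𝓘(ℝ, EM) (fun a : G ↦ a • p) 1) c X

/-- The bilinear form `⟨X^*_o, Y^*_o⟩` on the Lie algebra of `G`. -/
def baseForm (g : SmoothMetric 𝓘(ℝ, EM) (G ⧸ H)) :
    LinearMap.BilinForm ℝ (GroupLieAlgebra 𝓘(ℝ, E) G) :=
  LinearMap.mk₂ ℝ (fun X Y ↦ g.inner (basePoint H) (inducedField X (basePoint H))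
      (inducedField Y (basePoint H)))
    (by simp [inducedField_add]) (by simp [inducedField_smul]) (by simp [inducedField_add])
    (by simp [inducedField_smul])

omit [LieGroup 𝓘(ℝ, E) ∞ G] [IsManifold 𝓘(ℝ, EM) ∞ (G ⧸ H)] in
/-- A curve through `1` in `G` moves the base point with the velocity given by the induced field. -/
theorem mfderiv_smul_basePoint_of_curve
    (hA : ContMDiff (𝓘(ℝ, E).prod 𝓘(ℝ, EM)) 𝓘(ℝ, EM) ∞ (fun z : G × (G ⧸ H) ↦ z.1 • z.2))
    {γ : ℝ → G} (hγ : MDiffAt γ 0) (hγ0 : γ 0 = 1) :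
    (mfderiv 𝓘(ℝ, ℝ) 𝓘(ℝ, EM) (fun t ↦ γ t • basePoint H) 0 (1 : ℝ) : EM) =
      inducedField (mfderiv 𝓘(ℝ, ℝ) 𝓘(ℝ, E) γ 0 (1 : ℝ)) (basePoint H) :=
  mfderiv_comp_apply_of_eq (0 : ℝ) (y := (1 : G))
    ((contMDiff_smul_const hA (basePoint H)).mdifferentiableAt (by simp)) hγ hγ0 (1 : ℝ)

omit [IsManifold 𝓘(ℝ, EM) ∞ (G ⧸ H)] in
/-- The fields of the isotropy algebra vanish at the base point: curves in `H` fix `o`. -/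
theorem inducedField_basePoint_eq_zero
    (hA : ContMDiff (𝓘(ℝ, E).prod 𝓘(ℝ, EM)) 𝓘(ℝ, EM) ∞ (fun z : G × (G ⧸ H) ↦ z.1 • z.2))
    {X : GroupLieAlgebra 𝓘(ℝ, E) G} (hX : X ∈ subgroupLieAlgebra H) :
    inducedField (EM := EM) X (basePoint H) = 0 := by
  obtain ⟨γ, hγ, hγH, hγ0, rfl⟩ := hX
  have h1 := mfderiv_smul_basePoint_of_curve hA (hγ.mdifferentiableAt (x := 0) (by simp)) hγ0
  have h2 : (fun t ↦ γ t • basePoint H) = fun _ ↦ basePoint H := by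
    funext t
    rw [smul_basePoint]
    exact QuotientGroup.eq.2 (by simpa using H.inv_mem (hγH t))
  rw [h2, mfderiv_const] at h1
  exact h1.symm

theorem adjointRep_apply_inv (a : G) (X : GroupLieAlgebra 𝓘(ℝ, E) G) :
    adjointRep a (adjointRep a⁻¹ X) = X := by
  have h1 := mfderiv_comp_apply_of_eq (1 : G) (y := (1 : G))
    ((contMDiff_conj (E := E) a).mdifferentiableAt (by simp))
    ((contMDiff_conj (E := E) a⁻¹).mdifferentiableAt (by simp)) (by simp) X
  have h2 : (fun x : G ↦ a * x * a⁻¹) ∘ (fun x : G ↦ a⁻¹ * x * a⁻¹⁻¹) = id := by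
    funext x
    simp [mul_assoc]
  rw [h2] at h1
  refine h1.symm.trans ?_
  exact congrArg (fun L : E →L[ℝ] E ↦ L X) (mfderiv_id (I := 𝓘(ℝ, E)) (x := (1 : G)))

omit [IsManifold 𝓘(ℝ, EM) ∞ (G ⧸ H)] in
/-- The values of `X^*` are translates of values at the base point. -/
theorem inducedField_smul_basePoint
    (hA : ContMDiff (𝓘(ℝ, E).prod 𝓘(ℝ, EM)) 𝓘(ℝ, EM) ∞ (fun z : G × (G ⧸ H) ↦ z.1 • z.2))
    (a : G) (X : GroupLieAlgebra 𝓘(ℝ, E) G) :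
    inducedField (EM := EM) X (a • basePoint H) =
      mfderiv 𝓘(ℝ, EM) 𝓘(ℝ, EM) (fun q : G ⧸ H ↦ a • q) (basePoint H)
        (inducedField (adjointRep a⁻¹ X) (basePoint H)) := by
  rw [mfderiv_smul_inducedField hA, adjointRep_apply_inv]

variable [FiniteDimensional ℝ E] [FiniteDimensional ℝ EM]

/-- The exterior derivative of the metric dual of `ξ^*` at the base point, for a `G`-invariant
metric, expressed through the bracket: `adInvDeriv X Y` is `-[X, Y]`. The metric dual is tested on
the map `(a, b) ↦ ab • o`, whose partial derivatives along the axes are translates by `a` of a fixed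
vector at `o`, respectively values of an induced field. By invariance the functions to be
differentiated are given by `Ad(a⁻¹)` and `baseForm g` only. -/
theorem inner_leviCivita_inducedField_sub
    (hA : ContMDiff (𝓘(ℝ, E).prod 𝓘(ℝ, EM)) 𝓘(ℝ, EM) ∞ (fun z : G × (G ⧸ H) ↦ z.1 • z.2))
    (g : SmoothMetric 𝓘(ℝ, EM) (G ⧸ H))
    (hg : ∀ (a : G) (p : G ⧸ H) (u v : TangentSpace 𝓘(ℝ, EM) p),
      g.inner (a • p) (mfderiv 𝓘(ℝ, EM) 𝓘(ℝ, EM) (fun q : G ⧸ H ↦ a • q) p u)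
        (mfderiv 𝓘(ℝ, EM) 𝓘(ℝ, EM) (fun q : G ⧸ H ↦ a • q) p v) = g.inner p u v)
    (ξ Y Z : GroupLieAlgebra 𝓘(ℝ, E) G) :
    g.inner (basePoint H) (SmoothMetric.leviCivita g (inducedField ξ) (basePoint H)
        (inducedField Y (basePoint H))) (inducedField Z (basePoint H)) -
      g.inner (basePoint H) (SmoothMetric.leviCivita g (inducedField ξ) (basePoint H)
        (inducedField Z (basePoint H))) (inducedField Y (basePoint H)) =
    baseForm g (adInvDeriv Y ξ) Z - baseForm g (adInvDeriv Z ξ) Y -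
      baseForm g ξ (adInvDeriv Z Y) := by
  let y : E := Y
  let z : E := Z
  set φ := extChartAt 𝓘(ℝ, E) (1 : G) with hφ
  set o := basePoint H
  have hψ1 : φ.symm (φ 1) = 1 := extChartAt_to_inv (1 : G)
  have hψ : ContMDiffAt 𝓘(ℝ, E) 𝓘(ℝ, E) ∞ φ.symm (φ 1) := contMDiffAt_extChartAt_symm_self 1
  let s : E × E → G ⧸ H := fun e ↦ φ.symm e.1 • φ.symm e.2 • o
  have hse : s (φ 1, φ 1) = o := by simp [s, hψ1]
  have hs : ContMDiffAt 𝓘(ℝ, E × E) 𝓘(ℝ, EM) 2 s (φ 1, φ 1) :=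
    ((hA.contMDiffAt (x := (φ.symm (φ 1), φ.symm (φ 1) • o))).comp (φ 1, φ 1)
      ((contMDiffAt_chart_fst (E := E) G).prodMk
        (((contMDiff_smul_const hA o).contMDiffAt (x := φ.symm (φ 1))).comp (φ 1, φ 1)
          (contMDiffAt_chart_snd (E := E) G)))).of_le (by norm_cast)
  have hψd : MDiffAt φ.symm (φ 1) := hψ.mdifferentiableAt (by simp)
  have hL (a : G) : MDiffAt (fun q : G ⧸ H ↦ a • q) o :=
    (contMDiff_const_smul hA a).mdifferentiableAt (by simp)
  have hR (p : G ⧸ H) : MDiffAt (fun a : G ↦ a • p) 1 :=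
    (contMDiff_smul_const hA p).mdifferentiableAt (by simp)
  have hRψ (p : G ⧸ H) (w : E) :
      (mfderiv 𝓘(ℝ, E) 𝓘(ℝ, EM) (fun x : E ↦ φ.symm x • p) (φ 1) w : EM) =
        inducedField w p :=
    (mfderiv_comp_apply_of_eq (φ 1) (hR p) hψd hψ1 w).trans
      (congrArg (fun v : E ↦ (inducedField v p : EM)) (mfderiv_extChartAt_symm_self (1 : G) w))
  have hsd : ∀ᶠ e in 𝓝 (φ 1, φ 1), MDifferentiableAt 𝓘(ℝ, E × E) 𝓘(ℝ, EM) s e := by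
    filter_upwards [(contMDiffAt_iff_contMDiffAt_nhds (by simp)).1 hs] with e he
    exact he.mdifferentiableAt (by simp)
  -- the derivatives of `s` along the two axes
  have hs2 (x : E) (w : E) (hx : MDifferentiableAt 𝓘(ℝ, E × E) 𝓘(ℝ, EM) s (x, φ 1)) :
      (mfderiv 𝓘(ℝ, E × E) 𝓘(ℝ, EM) s (x, φ 1) ((0 : E), w) : EM) =
      mfderiv 𝓘(ℝ, EM) 𝓘(ℝ, EM) (fun q : G ⧸ H ↦ φ.symm x • q) o (inducedField w o) := by
    refine (mfderiv_prodMk_zero_left hx w).trans ?_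
    have hR' : MDiffAt (fun a : G ↦ a • o) (φ.symm (φ 1)) := by rw [hψ1]; exact hR o
    refine (mfderiv_comp_apply_of_eq (φ 1) (y := o) (g := fun q : G ⧸ H ↦ φ.symm x • q)
      (hL _) (hR'.comp (φ 1) hψd) (by simp [hψ1]) w).trans ?_
    exact congrArg (fun v : EM ↦
      (mfderiv 𝓘(ℝ, EM) 𝓘(ℝ, EM) (fun q : G ⧸ H ↦ φ.symm x • q) o v : EM)) (hRψ o w)
  have hs1 (x : E) (w : E) (hx : MDifferentiableAt 𝓘(ℝ, E × E) 𝓘(ℝ, EM) s (φ 1, x)) :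
      (mfderiv 𝓘(ℝ, E × E) 𝓘(ℝ, EM) s (φ 1, x) (w, (0 : E)) : EM) =
      inducedField w (φ.symm x • o) :=
    (mfderiv_prodMk_zero_right hx w).trans (hRψ (φ.symm x • o) w)
  have hat (q q' : G ⧸ H) (h : q = q') (v : E) :
      (inducedField v q : EM) = inducedField v q' := by subst h; rfl
  have hu : (mfderiv 𝓘(ℝ, E × E) 𝓘(ℝ, EM) s (φ 1, φ 1) (y, (0 : E)) : EM) =
      inducedField Y o :=
    (hs1 (φ 1) y hsd.self_of_nhds).trans (hat _ _ (by simp [hψ1]) y)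
  have hw : (mfderiv 𝓘(ℝ, E × E) 𝓘(ℝ, EM) s (φ 1, φ 1) ((0 : E), z) : EM) =
      inducedField Z o := by
    refine (mfderiv_prodMk_zero_left hsd.self_of_nhds z).trans ?_
    have h1 : (fun y' : E ↦ s (φ 1, y')) = fun y' ↦ φ.symm y' • o := by
      funext y'
      simp [s, hψ1]
    rw [h1]
    exact hRψ o z
  obtain ⟨a, c, ha, hc, hac⟩ := g.exists_hasDerivAt_inner_mfderiv_of_eq hse hs
    ((contMDiff_inducedField hA ξ).mdifferentiableAt (by simp)) hu hw
  have hF (q q' : G ⧸ H) (h : q = q') (v : EM) :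
      g.inner q (inducedField ξ q) v = g.inner q' (inducedField ξ q') v := by subst h; rfl
  have hcurve (w : E) : Filter.Tendsto (fun t : ℝ ↦ φ 1 + t • w) (𝓝 0) (𝓝 (φ 1)) :=
    Continuous.tendsto' (by fun_prop) _ _ (by simp)
  have hD (w : E) (v : E) := hasDerivAt_adjointRep_inv (E := E) (G := G)
    ((contMDiffAt_chartCurve (G := G) (E := E) w).mdifferentiableAt (by simp))
    (chartCurve_zero (G := G) w) (mfderiv_chartCurve (E := E) w) v
  have h0 (w : E) (v : GroupLieAlgebra 𝓘(ℝ, E) G) :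
      adjointRep (chartCurve (E := E) G w 0)⁻¹ v = v := by
    rw [chartCurve_zero, inv_one, adjointRep_one]
  have ha' : a = baseForm g (adInvDeriv Y ξ) Z := by
    have h1 := hasDerivAt_bilin_apply (V := E) (baseForm g) (hD y ξ)
      (hasDerivAt_const (F := E) (0 : ℝ) Z)
    refine (ha.unique (h1.congr_of_eventuallyEq ?_)).trans ?_
    · have t2 : Filter.Tendsto (fun x : E ↦ (x, φ 1)) (𝓝 (φ 1)) (𝓝 (φ 1, φ 1)) :=
        Continuous.tendsto' (by fun_prop) _ _ rfl
      filter_upwards [(t2.comp (hcurve y)).eventually hsd] with t ht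
      have e1 : (φ 1, φ 1) + t • (y, (0 : E)) = (φ 1 + t • y, φ 1) := by simp
      rw [e1]
      have e2 := hs2 (φ 1 + t • y) z ht
      have e3 : s (φ 1 + t • y, φ 1) = φ.symm (φ 1 + t • y) • o := by simp [s, hψ1]
      refine (congrArg (fun v : EM ↦ g.inner (s (φ 1 + t • y, φ 1))
        (inducedField ξ (s (φ 1 + t • y, φ 1))) v) e2).trans ?_
      refine (hF _ _ e3 _).trans ?_
      rw [inducedField_smul_basePoint hA]
      exact hg _ _ _ _
    · rw [map_zero, add_zero]
      rfl
  have hc' : c = baseForm g (adInvDeriv Z ξ) Y + baseForm g ξ (adInvDeriv Z Y) := by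
    have h1 := hasDerivAt_bilin_apply (V := E) (baseForm g) (hD z ξ) (hD z Y)
    refine (hc.unique (h1.congr_of_eventuallyEq ?_)).trans ?_
    · have t2 : Filter.Tendsto (fun x : E ↦ (φ 1, x)) (𝓝 (φ 1)) (𝓝 (φ 1, φ 1)) :=
        Continuous.tendsto' (by fun_prop) _ _ rfl
      filter_upwards [(t2.comp (hcurve z)).eventually hsd] with t ht
      have e1 : (φ 1, φ 1) + t • ((0 : E), z) = (φ 1, φ 1 + t • z) := by simp
      rw [e1]
      have e2 := hs1 (φ 1 + t • z) y ht
      have e3 : s (φ 1, φ 1 + t • z) = φ.symm (φ 1 + t • z) • o := by simp [s, hψ1]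
      refine (congrArg (fun v : EM ↦ g.inner (s (φ 1, φ 1 + t • z))
        (inducedField ξ (s (φ 1, φ 1 + t • z))) v) e2).trans ?_
      refine (hF _ _ e3 _).trans ?_
      refine (congrArg (fun v : EM ↦ g.inner (φ.symm (φ 1 + t • z) • o)
        (inducedField ξ (φ.symm (φ 1 + t • z) • o)) v)
        (inducedField_smul_basePoint hA (φ.symm (φ 1 + t • z)) Y)).trans ?_
      rw [inducedField_smul_basePoint hA]
      exact hg _ _ _ _
    · rw [h0, h0]
      rfl
  rw [← hac, ha', hc', sub_sub]

end

/-! ### Restriction to the fiber -/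

/-- The skew part of the covariant derivative of a field tangent to a submanifold is computed by
the induced metric: both sides are exterior derivatives of the metric dual, which restrict. -/
theorem SmoothMetric.inner_leviCivita_sub_of_isometric
    {E : Type*} [NormedAddCommGroup E] [NormedSpace ℝ E] [FiniteDimensional ℝ E]
    {M : Type*} [TopologicalSpace M] [ChartedSpace E M] [IsManifold 𝓘(ℝ, E) ∞ M]
    {E' : Type*} [NormedAddCommGroup E'] [NormedSpace ℝ E'] [FiniteDimensional ℝ E']
    {N : Type*} [TopologicalSpace N] [ChartedSpace E' N] [IsManifold 𝓘(ℝ, E') ∞ N]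
    (g : SmoothMetric 𝓘(ℝ, E) M) (gN : SmoothMetric 𝓘(ℝ, E') N) {ι : N → M} (hι : CMDiff ∞ ι)
    (hgN : ∀ (q : N) (u v : TangentSpace 𝓘(ℝ, E') q), gN.inner q u v =
      g.inner (ι q) (mfderiv 𝓘(ℝ, E') 𝓘(ℝ, E) ι q u) (mfderiv 𝓘(ℝ, E') 𝓘(ℝ, E) ι q v))
    {X : Π p : M, TangentSpace 𝓘(ℝ, E) p} {V : Π q : N, TangentSpace 𝓘(ℝ, E') q}
    (hV : ∀ q, mfderiv 𝓘(ℝ, E') 𝓘(ℝ, E) ι q (V q) = X (ι q)) {q : N}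
    (hVd : MDiffAt (T% V) q) (hXd : MDiffAt (T% X) (ι q)) (u w : TangentSpace 𝓘(ℝ, E') q) :
    gN.inner q (leviCivita gN V q u) w - gN.inner q (leviCivita gN V q w) u =
      g.inner (ι q) (leviCivita g X (ι q) (mfderiv 𝓘(ℝ, E') 𝓘(ℝ, E) ι q u))
          (mfderiv 𝓘(ℝ, E') 𝓘(ℝ, E) ι q w) -
        g.inner (ι q) (leviCivita g X (ι q) (mfderiv 𝓘(ℝ, E') 𝓘(ℝ, E) ι q w))
          (mfderiv 𝓘(ℝ, E') 𝓘(ℝ, E) ι q u) := by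
  set φ := extChartAt 𝓘(ℝ, E') q
  have hs : ContMDiffAt 𝓘(ℝ, E') 𝓘(ℝ, E') ∞ φ.symm (φ q) := contMDiffAt_extChartAt_symm_self q
  have hs0 : φ.symm (φ q) = q := extChartAt_to_inv q
  have hsd : ∀ᶠ x in 𝓝 (φ q), MDiffAt φ.symm x := by
    filter_upwards [(contMDiffAt_iff_contMDiffAt_nhds (n := 1) (by simp)).1
      (hs.of_le (by norm_cast))] with x hx
    exact hx.mdifferentiableAt one_ne_zero
  have hιd (q : N) : MDiffAt ι q := hι.mdifferentiableAt (by simp)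
  have hcomp (x : E') (hx : MDiffAt φ.symm x) (v : E') :
      (mfderiv 𝓘(ℝ, E') 𝓘(ℝ, E) (ι ∘ φ.symm) x v : E) =
        mfderiv 𝓘(ℝ, E') 𝓘(ℝ, E) ι (φ.symm x) (mfderiv 𝓘(ℝ, E') 𝓘(ℝ, E') φ.symm x v) :=
    mfderiv_comp_apply x (hιd _) hx v
  have hcomp0 (v : E') : (mfderiv 𝓘(ℝ, E') 𝓘(ℝ, E) (ι ∘ φ.symm) (φ q) v : E) =
      mfderiv 𝓘(ℝ, E') 𝓘(ℝ, E) ι q v :=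
    (mfderiv_comp_apply_of_eq (φ q) (hιd q) (hs.mdifferentiableAt (by simp)) hs0 v).trans
      (congrArg (fun v' : E' ↦ (mfderiv 𝓘(ℝ, E') 𝓘(ℝ, E) ι q v' : E))
        (mfderiv_extChartAt_symm_self q v))
  let u₀ : E' := u
  let w₀ : E' := w
  obtain ⟨a, c, ha, hc, hac⟩ := gN.exists_hasDerivAt_inner_mfderiv_of_eq hs0
    (hs.of_le (by norm_cast)) hVd (mfderiv_extChartAt_symm_self q u₀)
    (mfderiv_extChartAt_symm_self q w₀)
  obtain ⟨a', c', ha', hc', hac'⟩ := g.exists_hasDerivAt_inner_mfderiv_of_eq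
    (s := ι ∘ φ.symm) (p := ι q) (congrArg ι hs0)
    ((hι.contMDiffAt.comp (φ q) hs).of_le (by norm_cast)) hXd (hcomp0 u₀) (hcomp0 w₀)
  have hcurve (v : E') : Filter.Tendsto (fun t : ℝ ↦ φ q + t • v) (𝓝 0) (𝓝 (φ q)) :=
    Continuous.tendsto' (by fun_prop) _ _ (by simp)
  have key (x v : E') (hx : MDiffAt φ.symm x) :
      gN.inner (φ.symm x) (V (φ.symm x)) (mfderiv 𝓘(ℝ, E') 𝓘(ℝ, E') φ.symm x v) =
        g.inner ((ι ∘ φ.symm) x) (X ((ι ∘ φ.symm) x))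
          (mfderiv 𝓘(ℝ, E') 𝓘(ℝ, E) (ι ∘ φ.symm) x v) := by
    rw [hgN, hV]
    exact congrArg (fun v' : E ↦ g.inner (ι (φ.symm x)) (X (ι (φ.symm x))) v') (hcomp x hx v).symm
  have haa : a = a' := ha.unique (ha'.congr_of_eventuallyEq (by
    filter_upwards [(hcurve u₀).eventually hsd] with t ht using key _ w₀ ht))
  have hcc : c = c' := hc.unique (hc'.congr_of_eventuallyEq (by
    filter_upwards [(hcurve w₀).eventually hsd] with t ht using key _ u₀ ht))
  rw [← hac, ← hac', haa, hcc]

section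
variable {E : Type*} [NormedAddCommGroup E] [NormedSpace ℝ E]
  {G : Type*} [Group G] [TopologicalSpace G] [ChartedSpace E G] [LieGroup 𝓘(ℝ, E) ∞ G]
  {EM : Type*} [NormedAddCommGroup EM] [NormedSpace ℝ EM]
  {H K : Subgroup G} [ChartedSpace EM (G ⧸ H)] [IsManifold 𝓘(ℝ, EM) ∞ (G ⧸ H)]
  {EF : Type*} [NormedAddCommGroup EF] [NormedSpace ℝ EF]
  [ChartedSpace EF (K ⧸ H.subgroupOf K)] [IsManifold 𝓘(ℝ, EF) ∞ (K ⧸ H.subgroupOf K)]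

omit [IsManifold 𝓘(ℝ, EM) ∞ (G ⧸ H)]
  [IsManifold 𝓘(ℝ, EF) ∞ (K ⧸ H.subgroupOf K)] in
/-- The vectors `Y^*_o` with `Y` in the Lie algebra of `K` are tangent to the fiber `K/H`. -/
theorem exists_mfderiv_fiberInclusion_eq
    (hA : ContMDiff (𝓘(ℝ, E).prod 𝓘(ℝ, EM)) 𝓘(ℝ, EM) ∞ (fun z : G × (G ⧸ H) ↦ z.1 • z.2))
    (hincl : Manifold.IsSmoothEmbedding 𝓘(ℝ, EF) 𝓘(ℝ, EM) ∞ (fiberInclusion H K))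
    {Y : GroupLieAlgebra 𝓘(ℝ, E) G} (hY : Y ∈ subgroupLieAlgebra K) :
    ∃ v : TangentSpace 𝓘(ℝ, EF) ((1 : K) : K ⧸ H.subgroupOf K),
      (mfderiv 𝓘(ℝ, EF) 𝓘(ℝ, EM) (fiberInclusion H K) ((1 : K) : K ⧸ H.subgroupOf K) v : EM) =
        inducedField Y (basePoint H) := by
  obtain ⟨γ, hγ, hγK, hγ0, rfl⟩ := hY
  let c : ℝ → K ⧸ H.subgroupOf K := fun t ↦ ((⟨γ t, hγK t⟩ : K) : K ⧸ H.subgroupOf K)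
  have hc0 : c 0 = ((1 : K) : K ⧸ H.subgroupOf K) :=
    congrArg (fun k : K ↦ (k : K ⧸ H.subgroupOf K)) (Subtype.ext hγ0)
  have hιc : fiberInclusion H K ∘ c = fun t ↦ γ t • basePoint H :=
    funext fun t ↦ (smul_basePoint (γ t)).symm
  have h1 : ContMDiff 𝓘(ℝ, ℝ) 𝓘(ℝ, EM) ∞ (fiberInclusion H K ∘ c) := by
    rw [hιc]
    exact (contMDiff_smul_const hA (basePoint H)).comp hγ
  have hc : CMDiffAt ∞ c 0 :=
    (ContMDiffAt.iff_comp_isImmersionAt (hincl.isImmersion.isImmersionAt _)).2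
      ⟨(hincl.isEmbedding.continuous_iff.2 h1.continuous).continuousAt, h1.contMDiffAt⟩
  refine ⟨mfderiv 𝓘(ℝ, ℝ) 𝓘(ℝ, EF) c 0 (1 : ℝ), ?_⟩
  have h2 := mfderiv_comp_apply_of_eq (0 : ℝ) (hincl.contMDiff.mdifferentiableAt (by simp))
    (hc.mdifferentiableAt (by simp)) hc0 (1 : ℝ)
  rw [hιc] at h2
  exact h2.symm.trans (mfderiv_smul_basePoint_of_curve hA (hγ.mdifferentiableAt (by simp)) hγ0)

end

/-! ### The metrics of the canonical variation -/

section
variable {E : Type*} [NormedAddCommGroup E] [NormedSpace ℝ E]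
  {G : Type*} [Group G] [TopologicalSpace G] [ChartedSpace E G] [LieGroup 𝓘(ℝ, E) ∞ G]

omit [LieGroup 𝓘(ℝ, E) ∞ G] in
theorem adInvDeriv_add_left (X Y Z : GroupLieAlgebra 𝓘(ℝ, E) G) :
    adInvDeriv (X + Y) Z = adInvDeriv X Z + adInvDeriv Y Z :=
  map_add (fderiv ℝ (F := E) (fun x : E ↦
    adjointRep ((extChartAt 𝓘(ℝ, E) (1 : G)).symm x)⁻¹ Z) (extChartAt 𝓘(ℝ, E) (1 : G) 1)) X Y

theorem adInvDeriv_add_right (X Y Z : GroupLieAlgebra 𝓘(ℝ, E) G) :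
    adInvDeriv X (Y + Z) = adInvDeriv X Y + adInvDeriv X Z := by
  rw [adInvDeriv_skew X, adInvDeriv_add_left, neg_add, ← adInvDeriv_skew, ← adInvDeriv_skew]

theorem subgroupLieAlgebra_mono {H K : Subgroup G} (hHK : H ≤ K) :
    subgroupLieAlgebra (E := E) H ≤ subgroupLieAlgebra K := by
  rintro X ⟨γ, hγ, hγH, hγ0, hX⟩
  exact ⟨γ, hγ, fun t ↦ hHK (hγH t), hγ0, hX⟩

omit [LieGroup 𝓘(ℝ, E) ∞ G] in
/-- The decomposition `𝔤 = N ⊕ N^⊥`. -/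
theorem IsAdInvariantInner.exists_add_eq [FiniteDimensional ℝ E]
    {b : LinearMap.BilinForm ℝ (GroupLieAlgebra 𝓘(ℝ, E) G)} (hb : IsAdInvariantInner b)
    (N : Submodule ℝ (GroupLieAlgebra 𝓘(ℝ, E) G)) (X : GroupLieAlgebra 𝓘(ℝ, E) G) :
    ∃ Y ∈ N, ∃ Z ∈ b.orthogonal N, Y + Z = X := by
  have : FiniteDimensional ℝ (GroupLieAlgebra 𝓘(ℝ, E) G) := inferInstanceAs (FiniteDimensional ℝ E)
  have hrefl : b.IsRefl := fun Y Z h ↦ by rw [hb.symm, h]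
  have hc : IsCompl N (b.orthogonal N) := by
    rw [LinearMap.BilinForm.isCompl_orthogonal_iff_disjoint hrefl, Submodule.disjoint_def]
    intro Y hY hY'
    by_contra hne
    exact (hb.pos Y hne).ne' (hY' Y hY)
  exact Submodule.mem_sup.1 (hc.sup_eq_top ▸ Submodule.mem_top)

/-- The decomposition `𝔤 = 𝔥 ⊕ m₁ ⊕ m₂`. -/
theorem IsAdInvariantInner.exists_add_add_eq [FiniteDimensional ℝ E]
    {b : LinearMap.BilinForm ℝ (GroupLieAlgebra 𝓘(ℝ, E) G)} (hb : IsAdInvariantInner b)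
    {H K : Subgroup G} (hHK : H ≤ K) (X : GroupLieAlgebra 𝓘(ℝ, E) G) :
    ∃ X₀ ∈ subgroupLieAlgebra H, ∃ X₁ ∈ verticalSpace b H K, ∃ X₂ ∈ horizontalSpace b K,
      X = X₀ + X₁ + X₂ := by
  obtain ⟨Y, hY, X₂, hX₂, rfl⟩ := hb.exists_add_eq (subgroupLieAlgebra K) X
  obtain ⟨X₀, hX₀, X₁, hX₁, rfl⟩ := hb.exists_add_eq (subgroupLieAlgebra H) Y
  refine ⟨X₀, hX₀, X₁, ⟨hX₁, ?_⟩, X₂, hX₂, rfl⟩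
  exact (Submodule.add_mem_iff_right _ (subgroupLieAlgebra_mono hHK hX₀)).1 hY

variable [FiniteDimensional ℝ E]
  {EM : Type*} [NormedAddCommGroup EM] [NormedSpace ℝ EM]
  {H K : Subgroup G} [ChartedSpace EM (G ⧸ H)] [IsManifold 𝓘(ℝ, EM) ∞ (G ⧸ H)]
  {b : LinearMap.BilinForm ℝ (GroupLieAlgebra 𝓘(ℝ, E) G)} {lam : ℝ}
  {g : SmoothMetric 𝓘(ℝ, EM) (G ⧸ H)}

omit [LieGroup 𝓘(ℝ, E) ∞ G] [FiniteDimensional ℝ E] in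
theorem baseForm_comm (X Y : GroupLieAlgebra 𝓘(ℝ, E) G) : baseForm g X Y = baseForm g Y X :=
  g.symm _ _ _

/-- The summands of `𝔤 = 𝔥 ⊕ m₁ ⊕ m₂` are mutually orthogonal for `b`, and `𝔥` induces zero at the
base point, so only one of the arguments has to lie in `m₁ ⊕ m₂`. -/
theorem IsCanonicalVariation.baseForm_apply
    (hA : ContMDiff (𝓘(ℝ, E).prod 𝓘(ℝ, EM)) 𝓘(ℝ, EM) ∞ (fun z : G × (G ⧸ H) ↦ z.1 • z.2))
    (hg : IsCanonicalVariation b K lam g) (hb : IsAdInvariantInner b) (hHK : H ≤ K)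
    (X : GroupLieAlgebra 𝓘(ℝ, E) G) {Y₁ Y₂ : GroupLieAlgebra 𝓘(ℝ, E) G}
    (hY₁ : Y₁ ∈ verticalSpace b H K) (hY₂ : Y₂ ∈ horizontalSpace b K) :
    baseForm g X (Y₁ + Y₂) = lam * b X Y₁ + b X Y₂ := by
  obtain ⟨X₀, hX₀, X₁, hX₁, X₂, hX₂, rfl⟩ := hb.exists_add_add_eq hHK X
  have h0 : baseForm g X₀ (Y₁ + Y₂) = 0 := by
    change g.inner (basePoint H) (inducedField X₀ (basePoint H)) _ = 0
    rw [inducedField_basePoint_eq_zero hA hX₀, map_zero]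
    rfl
  have h1 : baseForm g (X₁ + X₂) (Y₁ + Y₂) = lam * b X₁ Y₁ + b X₂ Y₂ :=
    hg.apply_base X₁ hX₁ Y₁ hY₁ X₂ hX₂ Y₂ hY₂
  have e1 : b X₀ Y₁ = 0 := hY₁.1 X₀ hX₀
  have e2 : b X₀ Y₂ = 0 := hY₂ X₀ (subgroupLieAlgebra_mono hHK hX₀)
  have e3 : b X₁ Y₂ = 0 := hY₂ X₁ hX₁.2
  have e4 : b X₂ Y₁ = 0 := (hb.symm _ _).trans (hX₂ Y₁ hY₁.2)
  rw [add_assoc, LinearMap.map_add₂, h0, h1]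
  simp only [map_add, LinearMap.add_apply, e1, e2, e3, e4]
  ring

theorem IsCanonicalVariation.baseForm_vertical
    (hA : ContMDiff (𝓘(ℝ, E).prod 𝓘(ℝ, EM)) 𝓘(ℝ, EM) ∞ (fun z : G × (G ⧸ H) ↦ z.1 • z.2))
    (hg : IsCanonicalVariation b K lam g) (hb : IsAdInvariantInner b) (hHK : H ≤ K)
    (X : GroupLieAlgebra 𝓘(ℝ, E) G) {Y : GroupLieAlgebra 𝓘(ℝ, E) G}
    (hY : Y ∈ verticalSpace b H K) : baseForm g X Y = lam * b X Y := by
  have h := hg.baseForm_apply hA hb hHK X hY (zero_mem _)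
  rwa [map_zero, add_zero, add_zero] at h

variable [FiniteDimensional ℝ EM]

/-- The algebraic meaning of the hypothesis on the fiber: `[ξ, m₁]` has no component in `m₁`. -/
theorem adInvDeriv_apply_vertical_eq_zero
    (hA : ContMDiff (𝓘(ℝ, E).prod 𝓘(ℝ, EM)) 𝓘(ℝ, EM) ∞ (fun z : G × (G ⧸ H) ↦ z.1 • z.2))
    {EF : Type*} [NormedAddCommGroup EF] [NormedSpace ℝ EF] [FiniteDimensional ℝ EF]
    [ChartedSpace EF (K ⧸ H.subgroupOf K)] [IsManifold 𝓘(ℝ, EF) ∞ (K ⧸ H.subgroupOf K)]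
    (hincl : Manifold.IsSmoothEmbedding 𝓘(ℝ, EF) 𝓘(ℝ, EM) ∞ (fiberInclusion H K))
    (hHK : H ≤ K) (hb : IsAdInvariantInner b) (hlam : 0 < lam)
    (hg : IsCanonicalVariation b K lam g)
    {gF : SmoothMetric 𝓘(ℝ, EF) (K ⧸ H.subgroupOf K)} (hgF : IsInducedMetric g gF)
    {ξ : GroupLieAlgebra 𝓘(ℝ, E) G} (hξ : ξ ∈ verticalSpace b H K)
    {V : Π q : K ⧸ H.subgroupOf K, TangentSpace 𝓘(ℝ, EF) q}
    (hV : IsRestrictionToFiber (inducedField (EM := EM) (H := H) ξ) V)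
    (hVt : gF.IsInfinitesimalTransvection V ((1 : K) : K ⧸ H.subgroupOf K))
    {Y Z : GroupLieAlgebra 𝓘(ℝ, E) G} (hY : Y ∈ verticalSpace b H K)
    (hZ : Z ∈ verticalSpace b H K) : b (adInvDeriv Y ξ) Z = 0 := by
  obtain ⟨u, hu⟩ := exists_mfderiv_fiberInclusion_eq hA hincl hY.2
  obtain ⟨w, hw⟩ := exists_mfderiv_fiberInclusion_eq hA hincl hZ.2
  have h1 := SmoothMetric.inner_leviCivita_sub_of_isometric g gF hincl.contMDiff hgF hV
    (hVt.1.1.mdifferentiableAt (by simp))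
    ((contMDiff_inducedField hA ξ).mdifferentiableAt (by simp)) u w
  rw [hVt.2] at h1
  have h2 : (0 : ℝ) = g.inner (basePoint H) (SmoothMetric.leviCivita g (inducedField ξ)
        (basePoint H) (inducedField Y (basePoint H))) (inducedField Z (basePoint H)) -
      g.inner (basePoint H) (SmoothMetric.leviCivita g (inducedField ξ) (basePoint H)
        (inducedField Z (basePoint H))) (inducedField Y (basePoint H)) := by
    rw [← hu, ← hw]
    refine Eq.trans ?_ h1
    simp
  rw [inner_leviCivita_inducedField_sub hA g hg.invariant, baseForm_comm ξ,
    hg.baseForm_vertical hA hb hHK _ hZ, hg.baseForm_vertical hA hb hHK _ hY,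
    hg.baseForm_vertical hA hb hHK _ hξ] at h2
  have h3 := hb.adInvDeriv_skew Z Y ξ
  rw [hb.symm Y] at h3
  have h4 : lam * b (adInvDeriv Y ξ) Z = 0 := by linear_combination -h2 + lam * h3
  exact (mul_eq_zero.1 h4).resolve_left hlam.ne'

/-- For the parameter `2` the metric dual of `ξ^*` has vanishing exterior derivative at the base
point. -/
theorem inner_leviCivita_inducedField_sub_eq_zero
    (hA : ContMDiff (𝓘(ℝ, E).prod 𝓘(ℝ, EM)) 𝓘(ℝ, EM) ∞ (fun z : G × (G ⧸ H) ↦ z.1 • z.2))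
    (hHK : H ≤ K) (hb : IsAdInvariantInner b) (hg : IsCanonicalVariation b K 2 g)
    {ξ : GroupLieAlgebra 𝓘(ℝ, E) G} (hξ : ξ ∈ verticalSpace b H K)
    (hvert : ∀ Y ∈ verticalSpace b H K, ∀ Z ∈ verticalSpace b H K, b (adInvDeriv Y ξ) Z = 0)
    (Y Z : GroupLieAlgebra 𝓘(ℝ, E) G) :
    g.inner (basePoint H) (SmoothMetric.leviCivita g (inducedField ξ) (basePoint H)
        (inducedField Y (basePoint H))) (inducedField Z (basePoint H)) -
      g.inner (basePoint H) (SmoothMetric.leviCivita g (inducedField ξ) (basePoint H)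
        (inducedField Z (basePoint H))) (inducedField Y (basePoint H)) = 0 := by
  obtain ⟨Y₀, hY₀, Y₁, hY₁, Y₂, hY₂, rfl⟩ := hb.exists_add_add_eq hHK Y
  obtain ⟨Z₀, hZ₀, Z₁, hZ₁, Z₂, hZ₂, rfl⟩ := hb.exists_add_add_eq hHK Z
  have hred {W₀ : GroupLieAlgebra 𝓘(ℝ, E) G} (h : W₀ ∈ subgroupLieAlgebra H)
      (W₁ W₂ : GroupLieAlgebra 𝓘(ℝ, E) G) :
      inducedField (EM := EM) (W₀ + W₁ + W₂) (basePoint H) =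
        inducedField (W₁ + W₂) (basePoint H) := by
    rw [add_assoc, inducedField_add, inducedField_basePoint_eq_zero hA h, zero_add]
  rw [hred hY₀, hred hZ₀, inner_leviCivita_inducedField_sub hA g hg.invariant, baseForm_comm ξ,
    hg.baseForm_apply hA hb hHK _ hZ₁ hZ₂, hg.baseForm_apply hA hb hHK _ hY₁ hY₂,
    hg.baseForm_vertical hA hb hHK _ hξ]
  -- the bracket of `ξ` with `Y₁` is orthogonal to `m₁` by hypothesis and to `m₂` since it is in `𝔨`
  have k1 := hvert Y₁ hY₁ Z₁ hZ₁
  have k2 := adInvDeriv_apply_eq_zero b hY₁.2 hξ.2 hZ₂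
  have k3 := adInvDeriv_apply_eq_zero b hZ₁.2 hξ.2 hY₂
  have s₁₁ := hb.adInvDeriv_skew Z₁ Y₁ ξ
  have s₁₂ := hb.adInvDeriv_skew Z₂ Y₁ ξ
  have s₂₁ := hb.adInvDeriv_skew Y₂ Z₁ ξ
  -- for the pair `Y₂`, `Z₂` both skewness relations are needed, and this is where the factor `2`
  -- is used: `2 b([Z₂, Y₂], ξ)` is `b([Z₂, Y₂], ξ) - b([Y₂, Z₂], ξ)`
  have s₂₂ := hb.adInvDeriv_skew Z₂ Y₂ ξ
  have s₂₂' := hb.adInvDeriv_skew Y₂ Z₂ ξ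
  rw [hb.symm Y₁] at s₁₁ s₁₂
  rw [hb.symm Z₁, adInvDeriv_skew Y₂, map_neg, LinearMap.neg_apply] at s₂₁
  rw [hb.symm Y₂] at s₂₂
  rw [hb.symm Z₂, adInvDeriv_skew Y₂, map_neg, LinearMap.neg_apply] at s₂₂'
  simp only [adInvDeriv_add_left, adInvDeriv_add_right, map_add, LinearMap.add_apply]
  linear_combination 2 * k1 + k2 - k3 - 2 * s₁₁ - 2 * s₁₂ + 2 * s₂₁ - s₂₂ + s₂₂'
end

theorem mainTheorem7
    {E : Type*} [NormedAddCommGroup E] [NormedSpace ℝ E] [FiniteDimensional ℝ E]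
    {EM : Type*} [NormedAddCommGroup EM] [NormedSpace ℝ EM] [FiniteDimensional ℝ EM]
    {EF : Type*} [NormedAddCommGroup EF] [NormedSpace ℝ EF] [FiniteDimensional ℝ EF]
    -- a triple of compact Lie groups `H ≤ K ≤ G`
    {G : Type*} [Group G] [TopologicalSpace G] [T2Space G] [CompactSpace G]
    [ChartedSpace E G] [LieGroup 𝓘(ℝ, E) ∞ G]
    (H K : Subgroup G) (hH : IsClosed (H : Set G)) (hK : IsClosed (K : Set G)) (hHK : H ≤ K)
    -- the smooth structure of the total space `G/H`, for which `G → G/H` is a submersion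
    [ChartedSpace EM (G ⧸ H)] [IsManifold 𝓘(ℝ, EM) ∞ (G ⧸ H)]
    (hproj : Manifold.IsSubmersion 𝓘(ℝ, E) 𝓘(ℝ, EM) ∞ (fun a : G ↦ (a : G ⧸ H)))
    -- the smooth structure of the fiber `K/H`, an embedded submanifold of `G/H`
    [ChartedSpace EF (K ⧸ H.subgroupOf K)] [IsManifold 𝓘(ℝ, EF) ∞ (K ⧸ H.subgroupOf K)]
    (hincl : Manifold.IsSmoothEmbedding 𝓘(ℝ, EF) 𝓘(ℝ, EM) ∞ (fiberInclusion H K))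
    -- the background inner product on the Lie algebra of `G`
    (b : LinearMap.BilinForm ℝ (GroupLieAlgebra 𝓘(ℝ, E) G)) (hb : IsAdInvariantInner b)
    -- a canonical variation on `G/H` and the metric it induces on the fiber `K/H`
    (lam : ℝ) (hlam : 0 < lam)
    (g : SmoothMetric 𝓘(ℝ, EM) (G ⧸ H)) (hg : IsCanonicalVariation b K lam g)
    (gF : SmoothMetric 𝓘(ℝ, EF) (K ⧸ H.subgroupOf K)) (hgF : IsInducedMetric g gF)
    -- the canonical variation with parameter `2`
    (g₂ : SmoothMetric 𝓘(ℝ, EM) (G ⧸ H)) (hg₂ : IsCanonicalVariation b K 2 g₂)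
    (ξ : GroupLieAlgebra 𝓘(ℝ, E) G) (hξ : ξ ∈ verticalSpace b H K)
    -- `ξ^*` restricts to an infinitesimal transvection of the fiber at `o`
    (htrans : ∃ V : Π q : K ⧸ H.subgroupOf K, TangentSpace 𝓘(ℝ, EF) q,
      IsRestrictionToFiber (inducedField (EM := EM) (H := H) ξ) V ∧
      gF.IsInfinitesimalTransvection V ((1 : K) : K ⧸ H.subgroupOf K)) :
    g₂.IsInfinitesimalTransvection (inducedField ξ) (basePoint H) := by
  obtain ⟨V, hV, hVt⟩ := htrans
  have hA := contMDiff_smul_quotient hproj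
  have hself := inner_leviCivita_inducedField_self hA g₂ hg₂.invariant ξ
  refine ⟨SmoothMetric.isKilling_of_inner_leviCivita_self_eq_zero g₂
    (contMDiff_inducedField hA ξ) hself, ?_⟩
  have hvert := fun Y hY Z hZ ↦ adInvDeriv_apply_vertical_eq_zero hA hincl hHK hb hlam hg hgF hξ
    hV hVt (Y := Y) (Z := Z) hY hZ
  ext v
  refine SmoothMetric.ext_inner g₂ fun W _ ↦ ?_
  obtain ⟨Y, hY⟩ := exists_inducedField_basePoint_eq hproj v
  obtain ⟨Z, hZ⟩ := exists_inducedField_basePoint_eq hproj (W (basePoint H))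
  -- the covariant derivative of `ξ^*` at `o` is symmetric, and it is skew since `ξ^*` is Killing
  have hsymm := inner_leviCivita_inducedField_sub_eq_zero hA hHK hb hg₂ hξ hvert Y Z
  rw [hY, hZ] at hsymm
  have hskew := hself (basePoint H) (v + W (basePoint H))
  simp only [map_add, _root_.add_apply, hself, zero_add, add_zero] at hskew
  simp only [_root_.zero_apply, map_zero]
  linarith

end
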